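/- Let $G=GL(n;\mathbb C)$ and $p\ge 1$. Let $NG(q)=G^q$, with face operators $\varepsilon_0(h_1,\dots,h_q)=(h_2,\dots,h_q)$, $\varepsilon_i(h_1,\dots,h_q)=(h_1,\dots,h_ih_{i+1},\dots,h_q)$ for $0<i<q$, $\varepsilon_q(h_1,\dots,h_q)=(h_1,\dots,h_{q-1})$; let $N\bar G(q)=G^{q+1}$ and $\gamma:N\bar G(q)\to NG(q)$, $\gamma(g_0,\dots,g_q)=(g_0g_1^{-1},\dots,g_{q-1}g_q^{-1})$. On $\Delta^q\times N\bar G(q)$, with barycentric coordinates $t_0,\dots,t_q$ on $\Delta^q$, let $\theta=\sum_{i=0}^q t_i\theta_i$, where $\theta_i$ is the pullback of the Maurer–Cartan form $g^{-1}dg$ by the $i$-th projection $N\bar G(q)\to G$, let $\Omega=d\theta+\tfrac12[\theta,\theta]$, and let $\mathrm{ch}_p(\Omega)=\frac1{p!}\operatorname{tr}\bigl((-\Omega/2\pi i)^p\bigr)$. A simplicial $k$-form on $NG$ is a sequence of smooth complex $k$-forms $\Phi^{(q)}$ on $\Delta^q\times NG(q)$ with $(\varepsilon^i\times\mathrm{id})^*\Phi^{(q+1)}=(\mathrm{id}\times\varepsilon_i)^*\Phi^{(q)}$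 on $\Delta^q\times NG(q+1)$, where $\varepsilon^i:\Delta^q\to\Delta^{q+1}$ is the $i$-th face map. Then there is a simplicial $2p$-form $\Phi$ on $NG$ with $(\mathrm{id}\times\gamma)^*\Phi^{(q)}=\mathrm{ch}_p(\Omega)$ on $\Delta^q\times N\bar G(q)$ for all $q\ge 0$, and for every such $\Phi$ the component in $\Omega^{2p-1}(NG(1))=\Omega^{2p-1}(G)$ of the cochain $I_\Delta(\Phi)=\bigl(\int_{\Delta^q}\Phi^{(q)}\bigr)_{q}$ representing the $p$-th Chern character is $$\int_{\Delta^1}\Phi^{(1)}=\frac1{p!}\left(\frac1{2\pi i}\right)^p\frac1{\binom{2p-1}{p-1}}\operatorname{tr}\bigl((h^{-1}dh)^{2p-1}\bigr).$$ Here $\int_{\Delta^q}$ is integration over the fibre $\Delta^q$, normalized by $\int_{\Delta^q}f\,dt_1\wedge\cdots\wedge dt_q\wedge\beta=\bigl(\int_{\Delta^q}f\,dt_1\cdots dt_q\bigr)\beta$ for $\beta$ a form on $NG(q)$, and powers of matrix-valued forms are taken with the wedge product $(\alpha\wedge\beta)(u,v)=\alpha(u)\beta(v)-\alpha(v)\beta(u)$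 for one-forms. -/

import Mathlib

noncomputable section

namespace SimplicialDeRham

open scoped ContDiff

/-! ### Differential forms on (subsets of) normed spaces

A form is a function with values in the continuous alternating maps; only its values on the
relevant subset (an open set, or a solid simplex times an open set) matter.  The exterior
derivative is Mathlib's `extDeriv`. -/

/-- Continuous alternating `k`-linear maps `E^k → F`, for the topologies given by the norms. -/
abbrev Alt (E F : Type*) [NormedAddCommGroup E] [NormedSpace ℝ E]
    [NormedAddCommGroup F] [NormedSpace ℝ F] (k : ℕ) : Type _ :=
  E [⋀^Fin k]→L[ℝ] F

/-- Differential `k`-forms on a real normed space `E` with values in `F`. -/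
abbrev DForm (E F : Type*) [NormedAddCommGroup E] [NormedSpace ℝ E]
    [NormedAddCommGroup F] [NormedSpace ℝ F] (k : ℕ) : Type _ :=
  E → Alt E F k

section Forms

variable {E E' F F' A : Type*}
  [NormedAddCommGroup E] [NormedSpace ℝ E] [NormedAddCommGroup E'] [NormedSpace ℝ E']
  [NormedAddCommGroup F] [NormedSpace ℝ F] [NormedAddCommGroup F'] [NormedSpace ℝ F']
  [NormedRing A] [NormedAlgebra ℝ A]

/-- Pullback `f^* w`. -/
def pullback (f : E → E') {k : ℕ} (w : DForm E' F k) : DForm E F k :=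
  fun x => (w (f x)).compContinuousLinearMap (fderiv ℝ f x)

/-- Transport of an alternating map along an equality of degrees. -/
def castDeg {k l : ℕ} (h : k = l) (w : Alt E F k) : Alt E F l := h ▸ w

theorem castDeg_apply {k l : ℕ} (h : k = l) (w : Alt E F k) (v : Fin l → E) :
    castDeg h w v = w (fun i => v (Fin.cast h i)) := by
  subst h; rfl

/-- The (not antisymmetrized) product
`(v₁, …, v_{k+l}) ↦ f (v₁, …, v_k) * g (v_{k+1}, …, v_{k+l})`. -/
def mulMultilinear {k l : ℕ} (f : Alt E A k) (g : Alt E A l) :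
    ContinuousMultilinearMap ℝ (fun _ : Fin (k + l) => E) A where
  toFun v := f (fun i => v (Fin.castAdd l i)) * g (fun j => v (Fin.natAdd k j))
  map_update_add' := by
    intro inst v i x y
    obtain rfl : inst = instDecidableEqFin _ := Subsingleton.elim _ _
    refine Fin.addCases (fun i => ?_) (fun i => ?_) i
    · have h1 : ∀ z, (fun j => Function.update v (Fin.castAdd l i) z (Fin.castAdd l j))
          = Function.update (fun j => v (Fin.castAdd l j)) i z := by
        intro z; ext1 j; by_cases h : j = i
        · subst h; simp
        · rw [Function.update_of_ne h, Function.update_of_ne]; simpa using h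
      have h2 : ∀ z, (fun j => Function.update v (Fin.castAdd l i) z (Fin.natAdd k j))
          = fun j => v (Fin.natAdd k j) := by
        intro z; ext1 j
        rw [Function.update_of_ne]; intro h; have := congrArg Fin.val h; simp at this; omega
      simp only [h1, h2, ContinuousAlternatingMap.map_update_add, add_mul]
    · have h1 : ∀ z, (fun j => Function.update v (Fin.natAdd k i) z (Fin.natAdd k j))
          = Function.update (fun j => v (Fin.natAdd k j)) i z := by
        intro z; ext1 j; by_cases h : j = i
        · subst h; simp
        · rw [Function.update_of_ne h, Function.update_of_ne]; simpa using h
      have h2 : ∀ z, (fun j => Function.update v (Fin.natAdd k i) z (Fin.castAdd l j))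
          = fun j => v (Fin.castAdd l j) := by
        intro z; ext1 j
        rw [Function.update_of_ne]; intro h; have := congrArg Fin.val h; simp at this; omega
      simp only [h1, h2, ContinuousAlternatingMap.map_update_add, mul_add]
  map_update_smul' := by
    intro inst v i c x
    obtain rfl : inst = instDecidableEqFin _ := Subsingleton.elim _ _
    refine Fin.addCases (fun i => ?_) (fun i => ?_) i
    · have h1 : ∀ z, (fun j => Function.update v (Fin.castAdd l i) z (Fin.castAdd l j))
          = Function.update (fun j => v (Fin.castAdd l j)) i z := by
        intro z; ext1 j; by_cases h : j = i
        · subst h; simp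
        · rw [Function.update_of_ne h, Function.update_of_ne]; simpa using h
      have h2 : ∀ z, (fun j => Function.update v (Fin.castAdd l i) z (Fin.natAdd k j))
          = fun j => v (Fin.natAdd k j) := by
        intro z; ext1 j
        rw [Function.update_of_ne]; intro h; have := congrArg Fin.val h; simp at this; omega
      simp only [h1, h2, ContinuousAlternatingMap.map_update_smul, smul_mul_assoc]
    · have h1 : ∀ z, (fun j => Function.update v (Fin.natAdd k i) z (Fin.natAdd k j))
          = Function.update (fun j => v (Fin.natAdd k j)) i z := by
        intro z; ext1 j; by_cases h : j = i
        · subst h; simp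
        · rw [Function.update_of_ne h, Function.update_of_ne]; simpa using h
      have h2 : ∀ z, (fun j => Function.update v (Fin.natAdd k i) z (Fin.castAdd l j))
          = fun j => v (Fin.castAdd l j) := by
        intro z; ext1 j
        rw [Function.update_of_ne]; intro h; have := congrArg Fin.val h; simp at this; omega
      simp only [h1, h2, ContinuousAlternatingMap.map_update_smul, mul_smul_comm]
  cont := by
    refine (f.cont.comp (by fun_prop)).mul (g.cont.comp (by fun_prop))

/-- Wedge product of alternating maps with values in an algebra, without normalization factor
in front of the shuffle sum: for one-forms `(f ∧ g)(u, v) = f u * g v - f v * g u`.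
This convention matches that of `extDeriv`. -/
def wedge {k l : ℕ} (f : Alt E A k) (g : Alt E A l) :
    Alt E A (k + l) :=
  ((k.factorial * l.factorial : ℕ) : ℝ)⁻¹ •
    ContinuousMultilinearMap.alternatization (mulMultilinear f g)

/-- Wedge powers `f ∧ ⋯ ∧ f` (`m` factors). -/
def wedgePow {d : ℕ} (f : Alt E A d) : (m : ℕ) → Alt E A (m * d)
  | 0 => castDeg (Nat.zero_mul d).symm (ContinuousAlternatingMap.constOfIsEmpty ℝ E (Fin 0) 1)
  | m + 1 => castDeg (Nat.succ_mul m d).symm (wedge (wedgePow f m) f)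

/-- Insertion of the vectors `e₁, …, e_q` in the first `q` slots. -/
def insertVectors {q l : ℕ} (e : Fin q → E) (w : Alt E F (q + l)) :
    Alt E F l where
  toFun v := w (Fin.append e v)
  map_update_add' := by
    intro inst v i x y
    obtain rfl : inst = instDecidableEqFin _ := Subsingleton.elim _ _
    have h : ∀ z, Fin.append e (Function.update v i z)
        = Function.update (Fin.append e v) (Fin.natAdd q i) z := by
      intro z; ext1 j
      refine Fin.addCases (fun j => ?_) (fun j => ?_) j
      · rw [Function.update_of_ne]
        · simp
        · intro h; have := congrArg Fin.val h; simp at this; omega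
      · by_cases h : j = i
        · subst h; simp
        · rw [Function.update_of_ne (by simpa using h)]; simp [h]
    simp only [h, ContinuousAlternatingMap.map_update_add]
  map_update_smul' := by
    intro inst v i c x
    obtain rfl : inst = instDecidableEqFin _ := Subsingleton.elim _ _
    have h : ∀ z, Fin.append e (Function.update v i z)
        = Function.update (Fin.append e v) (Fin.natAdd q i) z := by
      intro z; ext1 j
      refine Fin.addCases (fun j => ?_) (fun j => ?_) j
      · rw [Function.update_of_ne]
        · simp
        · intro h; have := congrArg Fin.val h; simp at this; omega
      · by_cases h : j = i
        · subst h; simp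
        · rw [Function.update_of_ne (by simpa using h)]; simp [h]
    simp only [h, ContinuousAlternatingMap.map_update_smul]
  map_eq_zero_of_eq' := by
    intro v i j hv hij
    exact w.map_eq_zero_of_eq _ (i := Fin.natAdd q i) (j := Fin.natAdd q j)
      (by simpa using hv) (by simpa using hij)
  cont := by
    refine w.cont.comp (continuous_pi fun j => ?_)
    refine Fin.addCases (fun j => ?_) (fun j => ?_) j
    · simpa using continuous_const
    · simpa using continuous_apply j

end Forms

/-! ### Simplices, simplicial forms and integration over the simplices -/

/-- The standard simplex `Δ^q` in the coordinates `(t₁, …, t_q)`, with `t₀ = 1 - t₁ - ⋯ - t_q`. -/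
def simplex (q : ℕ) : Set (Fin q → ℝ) := {t | (∀ i, 0 ≤ t i) ∧ ∑ i, t i ≤ 1}

/-- All barycentric coordinates `(t₀, t₁, …, t_q)`. -/
def bary {q : ℕ} (t : Fin q → ℝ) : Fin (q + 1) → ℝ := Fin.cons (1 - ∑ i, t i) t

/-- The `i`-th face map `ε^i : Δ^q → Δ^{q+1}`, inserting `0` as `i`-th barycentric coordinate. -/
def simplexFace {q : ℕ} (i : Fin (q + 2)) (t : Fin q → ℝ) : Fin (q + 1) → ℝ :=
  fun j => (i.insertNth (0 : ℝ) (bary t) : Fin (q + 2) → ℝ) j.succ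

section Simplicial

variable {V : ℕ → Type*} [∀ q, NormedAddCommGroup (V q)] [∀ q, NormedSpace ℝ (V q)]

/-- `Φ` is a (smooth, complex valued) simplicial `k`-form on the simplicial manifold with
`X q ⊆ V q` open and face operators `ε`: a sequence of smooth `k`-forms on `Δ^q × X q` with
`(ε^i × id)^* Φ^{(q+1)} = (id × ε_i)^* Φ^{(q)}` on `Δ^q × X (q+1)`. -/
def IsSimplicialForm (X : ∀ q, Set (V q)) (ε : ∀ q, Fin (q + 2) → V (q + 1) → V q) (k : ℕ)
    (Φ : ∀ q, DForm ((Fin q → ℝ) × V q) ℂ k) : Prop :=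
  (∀ q, ContDiffOn ℝ ∞ (Φ q) (simplex q ×ˢ X q)) ∧
  ∀ q, ∀ i : Fin (q + 2), ∀ x ∈ simplex q ×ˢ X (q + 1),
    pullback (Prod.map (simplexFace i) id) (Φ (q + 1)) x =
      pullback (Prod.map id (ε q i)) (Φ q) x

/-- Integration over the fibre `Δ^q` of a form on `Δ^q × W` of degree `k = q + l`:
`f dt₁ ∧ ⋯ ∧ dt_q ∧ β ↦ (∫_{Δ^q} f dt₁ ⋯ dt_q) β`, for `β` a form on `W`; forms containing fewer
than `q` of the `dt_i` are sent to `0`. -/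
def fiberIntegral {W : Type*} [NormedAddCommGroup W] [NormedSpace ℝ W] (q l k : ℕ)
    (h : k = q + l) (w : DForm ((Fin q → ℝ) × W) ℂ k) : DForm W ℂ l :=
  fun x => ∫ t in simplex q,
    (insertVectors (fun i : Fin q => ((Pi.single i 1 : Fin q → ℝ), (0 : W)))
      (castDeg h (w (t, x)))).compContinuousLinearMap (ContinuousLinearMap.inr ℝ (Fin q → ℝ) W)

end Simplicial

/-! ### The simplicial bundle `N Ḡ → N G` for `G = GL(n; ℂ)` -/

/-- The algebra of complex `n × n` matrices; `GL(n; ℂ)` is the open subset of its units.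
It is normed by the operator norm for the sup norm on `ℂ^n`; the choice of the norm plays no role. -/
def Mat (n : ℕ) : Type := Matrix (Fin n) (Fin n) ℂ

section MatInstances

attribute [local instance] Matrix.linftyOpNormedRing Matrix.linftyOpNormedAlgebra

instance (n : ℕ) : NormedRing (Mat n) :=
  inferInstanceAs (NormedRing (Matrix (Fin n) (Fin n) ℂ))

instance (n : ℕ) : NormedAlgebra ℂ (Mat n) :=
  inferInstanceAs (NormedAlgebra ℂ (Matrix (Fin n) (Fin n) ℂ))

instance (n : ℕ) : FiniteDimensional ℂ (Mat n) :=
  inferInstanceAs (FiniteDimensional ℂ (Matrix (Fin n) (Fin n) ℂ))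

end MatInstances

/-- The trace of a matrix. -/
def matTrace (n : ℕ) : Mat n →L[ℝ] ℂ :=
  (LinearMap.toContinuousLinearMap
    (Matrix.traceLinearMap (Fin n) ℂ ℂ : Mat n →ₗ[ℂ] ℂ)).restrictScalars ℝ

theorem matTrace_apply (n : ℕ) (M : Matrix (Fin n) (Fin n) ℂ) :
    matTrace n M = Matrix.trace M := rfl

/-- `N G (q) = G^q`, `(h₁, …, h_q)` being indexed by `0, …, q - 1`. -/
def NG (n q : ℕ) : Set (Fin q → Mat n) := {h | ∀ i, IsUnit (h i)}

/-- `N Ḡ (q) = G^{q+1} ∋ (g₀, …, g_q)`. -/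
def NGbar (n q : ℕ) : Set (Fin (q + 1) → Mat n) := {g | ∀ i, IsUnit (g i)}

/-- The face operators `ε_i : N G (q+1) → N G (q)`:
`ε₀ (h₁, …, h_{q+1}) = (h₂, …, h_{q+1})`, `ε_{q+1} (h₁, …, h_{q+1}) = (h₁, …, h_q)` and
`ε_i (h₁, …, h_{q+1}) = (h₁, …, h_i h_{i+1}, …, h_{q+1})` otherwise. -/
def faceNG (n q : ℕ) (i : Fin (q + 2)) (h : Fin (q + 1) → Mat n) : Fin q → Mat n :=
  fun j =>
    if (j : ℕ) + 1 < i then h j.castSucc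
    else if (j : ℕ) + 1 = i then h j.castSucc * h j.succ
    else h j.succ

/-- `γ (g₀, …, g_q) = (g₀ g₁⁻¹, …, g_{q-1} g_q⁻¹)`. -/
def gammaMap (n q : ℕ) (g : Fin (q + 1) → Mat n) : Fin q → Mat n :=
  fun j => g j.castSucc * Ring.inverse (g j.succ)

/-- The Maurer–Cartan form `g⁻¹ dg` of `GL(n; ℂ)`, `v ↦ g⁻¹ v` on tangent vectors at `g`. -/
def maurerCartan (n : ℕ) : DForm (Mat n) (Mat n) 1 :=
  fun g => ContinuousAlternatingMap.ofSubsingleton ℝ (Mat n) (Mat n) (0 : Fin 1)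
    (ContinuousLinearMap.mul ℝ (Mat n) (Ring.inverse g))

/-- `θ_i = pr_i^* (g⁻¹ dg)` on `Δ^q × N Ḡ (q)`. -/
def thetaAt (n q : ℕ) (i : Fin (q + 1)) :
    DForm ((Fin q → ℝ) × (Fin (q + 1) → Mat n)) (Mat n) 1 :=
  pullback (fun x => x.2 i) (maurerCartan n)

/-- The canonical connection `θ = t₀ θ₀ + ⋯ + t_q θ_q` on `Δ^q × N Ḡ (q)`. -/
def connection (n q : ℕ) : DForm ((Fin q → ℝ) × (Fin (q + 1) → Mat n)) (Mat n) 1 :=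
  fun x => ∑ i, bary x.1 i • thetaAt n q i x

/-- Bracket `[α, β] = α ∧ β + β ∧ α` of matrix valued one-forms. -/
def bracket {E : Type*} [NormedAddCommGroup E] [NormedSpace ℝ E] {n : ℕ}
    (α β : Alt E (Mat n) 1) : Alt E (Mat n) (1 + 1) :=
  wedge α β + wedge β α

/-- The curvature `Ω = dθ + ½ [θ, θ]`. -/
def curvature (n q : ℕ) : DForm ((Fin q → ℝ) × (Fin (q + 1) → Mat n)) (Mat n) 2 :=
  fun x => (extDeriv (connection n q) x +
    (1 / 2 : ℝ) • bracket (connection n q x) (connection n q x) :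
      Alt ((Fin q → ℝ) × (Fin (q + 1) → Mat n)) (Mat n) (1 + 1))

/-- The trace of a matrix valued alternating map. -/
def trForm {E : Type*} [NormedAddCommGroup E] [NormedSpace ℝ E] {n k : ℕ}
    (α : Alt E (Mat n) k) : Alt E ℂ k :=
  (matTrace n).compContinuousAlternatingMap α

/-- The `2p`-form `ch_p(Ω) = (1/p!) tr ((-Ω / 2πi)^p)` on `Δ^q × N Ḡ (q)`. -/
def chernCharacterForm (n p q : ℕ) :
    DForm ((Fin q → ℝ) × (Fin (q + 1) → Mat n)) ℂ (2 * p) :=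
  fun x => (1 / (p.factorial : ℂ)) •
    trForm (castDeg (Nat.mul_comm p 2)
      (wedgePow ((-1 / (2 * Real.pi * Complex.I) : ℂ) • curvature n q x) p))

/-- `Φ` is the simplicial form on `N G` which represents `ch_p(Ω)` by Chern–Weil theory: it is a
simplicial `2p`-form on `N G` whose pullback by `γ` is `ch_p(Ω)`. -/
def IsChernCharacterSimplicialForm (n p : ℕ)
    (Φ : ∀ q, DForm ((Fin q → ℝ) × (Fin q → Mat n)) ℂ (2 * p)) : Prop :=
  IsSimplicialForm (NG n) (faceNG n) (2 * p) Φ ∧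
  ∀ q, ∀ x ∈ simplex q ×ˢ NGbar n q,
    pullback (Prod.map id (gammaMap n q)) (Φ q) x = chernCharacterForm n p q x

/-- The form `tr ((h⁻¹ dh)^m)` on `N G (1) = G`. -/
def trMaurerCartanPow (n m : ℕ) : DForm (Fin 1 → Mat n) ℂ m :=
  pullback (fun h => h 0)
    (fun g => trForm (castDeg (Nat.mul_one m) (wedgePow (maurerCartan n g) m)))

end SimplicialDeRham

end

noncomputable section

namespace SimplicialDeRham

/-! ### Wedge products -/

section Wedge

variable {E E' A B : Type*}
  [NormedAddCommGroup E] [NormedSpace ℝ E] [NormedAddCommGroup E'] [NormedSpace ℝ E']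
  [NormedRing A] [NormedAlgebra ℝ A] [NormedRing B] [NormedAlgebra ℝ B]

/-! Existence and uniqueness come from descent along `γ`, which is the quotient by simultaneous
right translation `g_i ↦ g_i u`. If `u` is a function `U`, each `g_i⁻¹ dg_i` becomes `U⁻¹ (g_i⁻¹
dg_i) U + U⁻¹ dU`. The added term is the same for every `i`, so `∑ t_i = 1` and `∑ dt_i = 0` make it
drop out of the curvature (`curvForm_add_const`). The curvature is therefore only conjugated, and
the trace of its powers is unchanged (`pullback_chernCharacterForm_gauge`).

Let `σ (h) = (h₁ ⋯ h_q, …, h_q, 1)` be the section `gammaSection`, and take `Φ = σ^* ch_p(Ω)`. Since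
`σ ∘ γ` is right translation by `g_q⁻¹`, gauge invariance gives `γ^* Φ = ch_p(Ω)`. Since `σ`
commutes with the faces up to right translation (`gammaSection_faceNG`), `Φ` is simplicial. Since `γ
∘ σ = id` on `N G`, every solution equals `σ^* ch_p(Ω)`.

For `q = 1` put `ω = h⁻¹ dh` and `t = t₁`. The pulled back connection is `(1 - t) ω`, so `-Ω = dt ∧
ω + t (1 - t) ω ∧ ω`. As `dt` commutes with `ω ∧ ω` and squares to zero, the part of `(-Ω)^p`
containing `dt` is `p (t (1 - t))^{p-1} dt ∧ ω^{2p-1}` (`wedgePow_cons_apply`). A Beta integral then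
gives `p ((p-1)!)² / (2p-1)! = 1 / binom(2p-1, p-1)`.

Wedge powers are computed without shuffles: `grassmann` turns alternating maps into elements of `A ⊗
Λ M` multiplicatively, which reduces the power formula to an identity in an associative algebra. -/

theorem wedge_apply {k l : ℕ} (f : Alt E A k) (g : Alt E A l) (v : Fin (k + l) → E) :
    wedge f g v = ((k.factorial * l.factorial : ℕ) : ℝ)⁻¹ •
      ∑ σ : Equiv.Perm (Fin (k + l)), Equiv.Perm.sign σ •
        (f (fun i => v (σ (Fin.castAdd l i))) * g (fun j => v (σ (Fin.natAdd k j)))) := by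
  rw [wedge, ContinuousAlternatingMap.smul_apply,
    ContinuousMultilinearMap.alternatization_apply_apply]
  rfl

theorem wedge_one_one_apply (f g : Alt E A 1) (v : Fin 2 → E) :
    wedge f g v = f (fun _ => v 0) * g (fun _ => v 1) - f (fun _ => v 1) * g (fun _ => v 0) := by
  have h := wedge_apply f g v
  rw [h]
  change _ • ∑ σ : Equiv.Perm (Fin 2), _ = _
  -- The permutations are indexed by the image of `0`: index `0` is the identity, index `1` the
  -- transposition.
  rw [Finset.univ_perm_fin_succ]
  simp only [Nat.factorial_one, mul_one, Nat.cast_one, inv_one, one_smul]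
  rw [Finset.sum_map]
  simp only [Fintype.sum_prod_type, Fin.sum_univ_two,
    Finset.univ_unique, Finset.sum_singleton, Equiv.coe_toEmbedding]
  have e1 : (fun i : Fin 1 => v ((Equiv.Perm.decomposeFin.symm ((0 : Fin 2), default))
      (Fin.castAdd 1 i))) = fun _ => v 0 := by
    funext i; fin_cases i; rfl
  have e2 : (fun i : Fin 1 => v ((Equiv.Perm.decomposeFin.symm ((0 : Fin 2), default))
      (Fin.natAdd 1 i))) = fun _ => v 1 := by
    funext i; fin_cases i; rfl
  have e3 : (fun i : Fin 1 => v ((Equiv.Perm.decomposeFin.symm ((1 : Fin 2), default))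
      (Fin.castAdd 1 i))) = fun _ => v 1 := by
    funext i; fin_cases i; rfl
  have e4 : (fun i : Fin 1 => v ((Equiv.Perm.decomposeFin.symm ((1 : Fin 2), default))
      (Fin.natAdd 1 i))) = fun _ => v 0 := by
    funext i; fin_cases i; rfl
  have s1 : Equiv.Perm.sign (Equiv.Perm.decomposeFin.symm ((0 : Fin 2), default)) = 1 := by
    decide
  have s2 : Equiv.Perm.sign (Equiv.Perm.decomposeFin.symm ((1 : Fin 2), default)) = -1 := by
    decide
  rw [e1, e2, e3, e4, s1, s2, one_smul, sub_eq_add_neg]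
  congr 1
  simp [Units.smul_def]

theorem wedge_map {k l : ℕ} {f : Alt E A k} {g : Alt E A l} {f' : Alt E' B k} {g' : Alt E' B l}
    (φ : A →ₐ[ℝ] B) (L : E' → E) (hf : ∀ v, f' v = φ (f (L ∘ v)))
    (hg : ∀ v, g' v = φ (g (L ∘ v))) (v : Fin (k + l) → E') :
    wedge f' g' v = φ (wedge f g (L ∘ v)) := by
  rw [wedge_apply, wedge_apply, map_smul, map_sum]
  congr 1
  refine Finset.sum_congr rfl fun σ _ => ?_
  rw [hf, hg, ← map_mul, Units.smul_def, Units.smul_def, map_zsmul]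
  rfl

/-- Only values are compared, so `L` need not be linear. Conjugation of the coefficients (`L = id`)
and pullback along a derivative (`φ = id`) are both instances. -/
theorem wedgePow_map {d : ℕ} {f : Alt E A d} {f' : Alt E' B d} (φ : A →ₐ[ℝ] B) (L : E' → E)
    (hf : ∀ v, f' v = φ (f (L ∘ v))) (m : ℕ) (v : Fin (m * d) → E') :
    wedgePow f' m v = φ (wedgePow f m (L ∘ v)) := by
  induction m with
  | zero => simp [wedgePow, castDeg_apply]
  | succ m ih =>
    rw [wedgePow, wedgePow, castDeg_apply, castDeg_apply]
    exact wedge_map φ L ih hf _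

theorem wedgePow_smul {A : Type*} [NormedRing A] [NormedAlgebra ℂ A] {d : ℕ} (c : ℂ)
    (f : Alt E A d) (m : ℕ) : wedgePow (c • f) m = c ^ m • wedgePow f m := by
  induction m with
  | zero => simp [wedgePow]
  | succ m ih =>
    ext v
    rw [wedgePow, wedgePow, ih, ContinuousAlternatingMap.smul_apply, castDeg_apply, castDeg_apply,
      wedge_apply, wedge_apply, smul_comm (c ^ (m + 1))]
    congr 1
    rw [Finset.smul_sum]
    refine Finset.sum_congr rfl fun σ _ => ?_
    simp only [ContinuousAlternatingMap.smul_apply]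
    rw [smul_mul_smul_comm, ← pow_succ, smul_comm]

end Wedge

/-! ### The Grassmann generating element of an alternating map -/

section Grassmann

open TensorProduct

variable {E A M ι : Type*} [NormedAddCommGroup E] [NormedSpace ℝ E]
  [NormedRing A] [NormedAlgebra ℝ A] [AddCommGroup M] [Module ℝ M] [Fintype ι]

/-- The element `(1/k!) ∑ f (v_{i₁}, …, v_{i_k}) ⊗ X_{i₁} ⋯ X_{i_k}` of `A ⊗ Λ M`. -/
def grassmann (v : ι → E) (X : ι → M) {k : ℕ} (f : Alt E A k) : A ⊗[ℝ] ExteriorAlgebra ℝ M :=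
  (k.factorial : ℝ)⁻¹ • ∑ I : Fin k → ι, f (v ∘ I) ⊗ₜ[ℝ] ExteriorAlgebra.ιMulti ℝ k (X ∘ I)

theorem grassmann_castDeg (v : ι → E) (X : ι → M) {k l : ℕ} (h : k = l) (f : Alt E A k) :
    grassmann v X (castDeg h f) = grassmann v X f := by
  subst h; rfl

/-- Antisymmetrizing the coefficients is redundant against the already antisymmetric products of the
`X i`. Each permutation contributes the same sum, and the resulting factor `(k + l)!` cancels the
normalization of `grassmann`. -/
theorem grassmann_wedge (v : ι → E) (X : ι → M) {k l : ℕ} (f : Alt E A k) (g : Alt E A l) :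
    grassmann v X (wedge f g) = grassmann v X f * grassmann v X g := by
  set F : (Fin (k + l) → ι) → A ⊗[ℝ] ExteriorAlgebra ℝ M := fun I =>
    (f (fun i => v (I (Fin.castAdd l i))) * g (fun j => v (I (Fin.natAdd k j)))) ⊗ₜ[ℝ]
      ExteriorAlgebra.ιMulti ℝ (k + l) (X ∘ I) with hF
  have h1 : ∑ I : Fin (k + l) → ι, wedge f g (v ∘ I) ⊗ₜ[ℝ]
      ExteriorAlgebra.ιMulti ℝ (k + l) (X ∘ I) =
      ((k.factorial * l.factorial : ℕ) : ℝ)⁻¹ • ((k + l).factorial : ℝ) • ∑ I, F I := by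
    simp only [wedge_apply, ← TensorProduct.smul_tmul', TensorProduct.sum_tmul,
      ← Finset.smul_sum]
    congr 1
    rw [Finset.sum_comm]
    -- Reindexing the multi-index `I` by `σ` produces a second sign from the exterior factor, which
    -- cancels `sign σ`.
    have h2 : ∀ σ : Equiv.Perm (Fin (k + l)), (∑ I : Fin (k + l) → ι,
        Equiv.Perm.sign σ • ((f (fun i => (v ∘ I) (σ (Fin.castAdd l i))) *
          g (fun j => (v ∘ I) (σ (Fin.natAdd k j)))) ⊗ₜ[ℝ]
          ExteriorAlgebra.ιMulti ℝ (k + l) (X ∘ I))) = ∑ I, F I := by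
      intro σ
      rw [← Equiv.sum_comp (Equiv.arrowCongr σ.symm (Equiv.refl ι)) F]
      refine Finset.sum_congr rfl fun I _ => ?_
      have h3 : ExteriorAlgebra.ιMulti ℝ (k + l)
          (X ∘ (Equiv.arrowCongr σ.symm (Equiv.refl ι)) I) =
          Equiv.Perm.sign σ • ExteriorAlgebra.ιMulti ℝ (k + l) (X ∘ I) := by
        rw [← AlternatingMap.map_perm]
        rfl
      simp only [hF, h3]
      rcases Int.units_eq_one_or (Equiv.Perm.sign σ) with h | h <;>
        simp [h, Units.smul_def, TensorProduct.tmul_neg]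
    refine (Finset.sum_congr rfl fun σ _ => h2 σ).trans ?_
    simp only [Finset.sum_const, Finset.card_univ, Fintype.card_perm, Fintype.card_fin]
    rw [Nat.cast_smul_eq_nsmul]
  -- A multi-index of length `k + l` is a concatenation of one of length `k` and one of length `l`.
  have h4 : (∑ I : Fin k → ι, f (v ∘ I) ⊗ₜ[ℝ] ExteriorAlgebra.ιMulti ℝ k (X ∘ I)) *
      (∑ J : Fin l → ι, g (v ∘ J) ⊗ₜ[ℝ] ExteriorAlgebra.ιMulti ℝ l (X ∘ J)) = ∑ I, F I := by
    rw [← Equiv.sum_comp (Fin.appendEquiv k l) F, Fintype.sum_prod_type, Finset.sum_mul_sum]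
    refine Finset.sum_congr rfl fun I _ => Finset.sum_congr rfl fun J _ => ?_
    rw [Algebra.TensorProduct.tmul_mul_tmul]
    simp only [hF, Fin.appendEquiv, Equiv.coe_fn_mk, Fin.append_left, Fin.append_right]
    congr 1
    simp only [ExteriorAlgebra.ιMulti_apply, ← List.prod_append, ← List.ofFn_fin_append]
    congr 2
    funext i
    refine Fin.addCases (fun i => ?_) (fun i => ?_) i <;> simp
  rw [grassmann, grassmann, grassmann, h1, smul_mul_smul_comm, h4, smul_smul, smul_smul]
  congr 1
  have : ((k + l).factorial : ℝ) ≠ 0 := by positivity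
  push_cast
  field_simp

theorem grassmann_wedgePow (v : ι → E) (X : ι → M) {d : ℕ} (f : Alt E A d) (m : ℕ) :
    grassmann v X (wedgePow f m) = grassmann v X f ^ m := by
  induction m with
  | zero =>
    rw [wedgePow, grassmann_castDeg]
    simp [grassmann, Algebra.TensorProduct.one_def]
  | succ m ih => rw [wedgePow, grassmann_castDeg, grassmann_wedge, ih, pow_succ]

theorem grassmann_one (v : ι → E) (X : ι → M) (f : Alt E A 1) :
    grassmann v X f = ∑ i, f (fun _ => v i) ⊗ₜ[ℝ] ExteriorAlgebra.ι ℝ (X i) := by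
  rw [grassmann, ← Equiv.sum_comp (Equiv.funUnique (Fin 1) ι).symm]
  simp only [Nat.factorial_one, Nat.cast_one, inv_one, one_smul]
  refine Finset.sum_congr rfl fun i _ => ?_
  congr 1
  simp [ExteriorAlgebra.ιMulti_apply]

/-- Every multi-index longer than the number of vectors repeats an entry, which kills the exterior
product. -/
theorem grassmann_of_lt (v : ι → E) (X : ι → M) {k : ℕ} (f : Alt E A k)
    (h : Fintype.card ι < k) : grassmann v X f = 0 := by
  rw [grassmann, Finset.sum_eq_zero, smul_zero]
  intro I _
  have hI : ¬ Function.Injective I := fun hI => by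
    have := Fintype.card_le_of_injective I hI
    simp only [Fintype.card_fin] at this
    omega
  rw [AlternatingMap.map_eq_zero_of_not_injective _ _ (fun h' => hI h'.of_comp),
    TensorProduct.tmul_zero]

/-- Only bijective multi-indices survive. The signs of `f` and of the exterior product cancel, so
the `k!` terms are equal. With `tmul_ιMulti_basis_injective` this recovers `f v` from its generating
element. -/
theorem grassmann_top {k : ℕ} (v : Fin k → E) (X : Fin k → M) (f : Alt E A k) :
    grassmann v X f = f v ⊗ₜ[ℝ] ExteriorAlgebra.ιMulti ℝ k X := by
  have h : ∑ I : Fin k → Fin k, f (v ∘ I) ⊗ₜ[ℝ] ExteriorAlgebra.ιMulti ℝ k (X ∘ I) =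
      ∑ σ : Equiv.Perm (Fin k), f v ⊗ₜ[ℝ] ExteriorAlgebra.ιMulti ℝ k X := by
    symm
    refine Finset.sum_of_injOn (fun σ => (σ : Fin k → Fin k))
      (fun σ _ τ _ h => DFunLike.coe_injective h) (fun σ _ => by simp) ?_ ?_
    · intro I _ hI
      have hI' : ¬ Function.Injective I := fun hinj => hI
        ⟨Equiv.ofBijective I (Finite.injective_iff_bijective.1 hinj), by simp, rfl⟩
      rw [AlternatingMap.map_eq_zero_of_not_injective _ _ (fun h' => hI' h'.of_comp),
        TensorProduct.tmul_zero]
    · intro σ _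
      have h1 : f (v ∘ σ) = Equiv.Perm.sign σ • f v := f.toAlternatingMap.map_perm v σ
      rw [AlternatingMap.map_perm, h1]
      rcases Int.units_eq_one_or (Equiv.Perm.sign σ) with h | h <;>
        simp [h, Units.smul_def, TensorProduct.neg_tmul, TensorProduct.tmul_neg]
  rw [grassmann, h, Finset.sum_const, Finset.card_univ, Fintype.card_perm, Fintype.card_fin,
    ← Nat.cast_smul_eq_nsmul ℝ, smul_smul, inv_mul_cancel₀ (by positivity), one_smul]

theorem tmul_ιMulti_basis_injective {k : ℕ} {a b : A}
    (h : a ⊗ₜ[ℝ] ExteriorAlgebra.ιMulti ℝ k (fun i => (Pi.single i 1 : Fin k → ℝ)) =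
      b ⊗ₜ[ℝ] ExteriorAlgebra.ιMulti ℝ k (fun i => (Pi.single i 1 : Fin k → ℝ))) : a = b := by
  classical
  -- The exterior factor is detected by the determinant in degree `k`. A functional on the exterior
  -- algebra needs a value in every degree, so it is set to zero in the others.
  let D : ∀ i, (Fin k → ℝ) [⋀^Fin i]→ₗ[ℝ] ℝ := fun i =>
    if h : k = i then h ▸ (Matrix.detRowAlternating : (Fin k → ℝ) [⋀^Fin k]→ₗ[ℝ] ℝ) else 0
  have hD : ExteriorAlgebra.liftAlternating D
      (ExteriorAlgebra.ιMulti ℝ k (fun i => (Pi.single i 1 : Fin k → ℝ))) = 1 := by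
    rw [ExteriorAlgebra.liftAlternating_apply_ιMulti]
    simp only [D, dite_true]
    have : (fun i => (Pi.single i 1 : Fin k → ℝ)) = (1 : Matrix (Fin k) (Fin k) ℝ) := by
      ext i j
      simp [Matrix.one_apply, Pi.single_apply, eq_comm]
    rw [this]
    exact Matrix.det_one
  have h' := congrArg (fun z => TensorProduct.rid ℝ A
    (LinearMap.lTensor A (ExteriorAlgebra.liftAlternating D) z)) h
  simpa [LinearMap.lTensor_tmul, hD] using h'

/-- Anticommuting with `W`, the element `d` commutes with `W²`. Since `d² = 0`, at most one factor
`d * W` survives, and its `j + 1` possible positions give equal terms. -/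
theorem pow_succ_mul_add_smul_sq {R : Type*} [Ring R] [Algebra ℝ R] (d W : R) (s : ℝ)
    (hdd : d * d = 0) (hdW : W * d = -(d * W)) (j : ℕ) :
    (d * W + s • (W * W)) ^ (j + 1) =
      s ^ (j + 1) • W ^ (2 * (j + 1)) + ((j + 1 : ℝ) * s ^ j) • (d * W ^ (2 * j + 1)) := by
  have hc : ∀ j, d * W ^ (2 * j) = W ^ (2 * j) * d := by
    intro j
    have h : Commute d (W ^ 2) := by
      rw [Commute, SemiconjBy, pow_two, mul_assoc W W d, hdW, mul_neg, ← mul_assoc W d W, hdW,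
        neg_mul, neg_neg, mul_assoc]
    rw [pow_mul]
    exact h.pow_right j
  have hz : ∀ j, d * W ^ (2 * j + 1) * (d * W) = 0 := by
    intro j
    have h : d * W ^ (2 * j + 1) * (d * W) = W ^ (2 * j) * d * (W * d) * W := by
      rw [pow_succ, ← mul_assoc d, hc]
      simp only [mul_assoc]
    rw [h, hdW, mul_neg, mul_assoc (W ^ (2 * j)) d, ← mul_assoc d d W, hdd]
    simp
  induction j with
  | zero => simp [pow_two, add_comm]
  | succ j ih =>
    have h1 : W ^ (2 * (j + 1)) * (d * W) = d * W ^ (2 * (j + 1) + 1) := by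
      rw [← mul_assoc, ← hc, pow_succ, mul_assoc]
    have h2 : W ^ (2 * (j + 1)) * (W * W) = W ^ (2 * (j + 1 + 1)) := by
      rw [← pow_two, ← pow_add, ← mul_add_one]
    have h3 : d * W ^ (2 * j + 1) * (W * W) = d * W ^ (2 * (j + 1) + 1) := by
      rw [mul_assoc, ← pow_two, ← pow_add, mul_add 2, add_right_comm]
    rw [pow_succ, ih, add_mul (s ^ (j + 1) • W ^ (2 * (j + 1))),
      mul_add (s ^ (j + 1) • W ^ (2 * (j + 1))), mul_add (((j + 1 : ℝ) * s ^ j) • (d * W ^ (2 * j + 1)))]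
    simp only [smul_mul_assoc, mul_smul_comm, h1, h2, h3, hz]
    rw [smul_zero, zero_add]
    push_cast
    module

/-- The powers of `K = δ ∧ ω + s ω ∧ ω`, evaluated on a vector `e` with `δ e = 1`, `ω e = 0`
followed by vectors in the kernel of `δ`. -/
theorem wedgePow_cons_apply (K : Alt E A 2) (ω : Alt E A 1) (δ : E → ℝ) (s : ℝ)
    (hK : ∀ u : Fin 2 → E, K u = δ (u 0) • ω (fun _ => u 1) - δ (u 1) • ω (fun _ => u 0) +
      s • (ω (fun _ => u 0) * ω (fun _ => u 1) - ω (fun _ => u 1) * ω (fun _ => u 0)))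
    (m : ℕ) (e : E) (w : Fin (2 * m + 1) → E) (he : δ e = 1) (hωe : ω (fun _ => e) = 0)
    (hw : ∀ i, δ (w i) = 0) (h1 : (m + 1) * 2 = 2 * m + 1 + 1)
    (h2 : (2 * m + 1) * 1 = 2 * m + 1) :
    castDeg h1 (wedgePow K (m + 1)) (Fin.cons e w : Fin (2 * m + 1 + 1) → E) =
      ((m + 1 : ℝ) * s ^ m) • castDeg h2 (wedgePow ω (2 * m + 1)) w := by
  set v : Fin (2 * m + 1 + 1) → E := Fin.cons e w with hv
  set X : Fin (2 * m + 1 + 1) → (Fin (2 * m + 1 + 1) → ℝ) := fun i => Pi.single i 1 with hX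
  apply tmul_ιMulti_basis_injective
  rw [← hX, ← grassmann_top, grassmann_castDeg, grassmann_wedgePow]
  set d : A ⊗[ℝ] ExteriorAlgebra ℝ (Fin (2 * m + 1 + 1) → ℝ) :=
    1 ⊗ₜ[ℝ] ExteriorAlgebra.ι ℝ (X 0) with hd
  set Y : Fin (2 * m + 1) → (Fin (2 * m + 1 + 1) → ℝ) := fun i => X i.succ with hY
  -- The vector `e` contributes nothing because `ω e = 0`, so `W` involves only the `2 * m + 1`
  -- vectors `w`.
  have hω : grassmann v X ω = grassmann w Y ω := by
    rw [grassmann_one, grassmann_one, Fin.sum_univ_succ]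
    simp [hv, hωe, hY]
  set W := grassmann w Y ω with hW
  have hdd : d * d = 0 := by
    simp [hd, Algebra.TensorProduct.tmul_mul_tmul]
  have hdW : W * d = - (d * W) := by
    rw [hW, grassmann_one, Finset.sum_mul, Finset.mul_sum, ← Finset.sum_neg_distrib]
    refine Finset.sum_congr rfl fun i _ => ?_
    rw [hd, Algebra.TensorProduct.tmul_mul_tmul, Algebra.TensorProduct.tmul_mul_tmul,
      ← TensorProduct.tmul_neg, mul_one, one_mul,
      eq_neg_of_add_eq_zero_left (ExteriorAlgebra.ι_add_mul_swap (Y i) (X 0))]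
  have hKd : grassmann v X K = d * W + s • (W * W) := by
    have hδ : d = ∑ i, (δ (v i) • (1 : A)) ⊗ₜ[ℝ] ExteriorAlgebra.ι ℝ (X i) := by
      rw [Fin.sum_univ_succ]
      simp [hv, he, hw, hd]
    -- Summing over ordered pairs counts each term twice. The factor `2` cancels the `1 / 2!` in
    -- `grassmann`.
    have key : ∑ i, ∑ j, K ![v i, v j] ⊗ₜ[ℝ] (ExteriorAlgebra.ι ℝ (X i) * ExteriorAlgebra.ι ℝ (X j))
        = (2 : ℝ) • (d * W + s • (W * W)) := by
      have e1 : ∑ i, ∑ j, (δ (v i) • ω (fun _ => v j)) ⊗ₜ[ℝ]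
          (ExteriorAlgebra.ι ℝ (X i) * ExteriorAlgebra.ι ℝ (X j)) = d * W := by
        rw [hδ, ← hω, grassmann_one, Finset.sum_mul_sum]
        simp [Algebra.TensorProduct.tmul_mul_tmul]
      have e2 : ∑ i, ∑ j, (δ (v j) • ω (fun _ => v i)) ⊗ₜ[ℝ]
          (ExteriorAlgebra.ι ℝ (X i) * ExteriorAlgebra.ι ℝ (X j)) = - (d * W) := by
        rw [← hdW, hδ, ← hω, grassmann_one, Finset.sum_mul_sum]
        simp [Algebra.TensorProduct.tmul_mul_tmul]
      have e3 : ∑ i, ∑ j, (ω (fun _ => v i) * ω (fun _ => v j)) ⊗ₜ[ℝ]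
          (ExteriorAlgebra.ι ℝ (X i) * ExteriorAlgebra.ι ℝ (X j)) = W * W := by
        rw [← hω, grassmann_one, Finset.sum_mul_sum]
        simp [Algebra.TensorProduct.tmul_mul_tmul]
      have e4 : ∑ i, ∑ j, (ω (fun _ => v j) * ω (fun _ => v i)) ⊗ₜ[ℝ]
          (ExteriorAlgebra.ι ℝ (X i) * ExteriorAlgebra.ι ℝ (X j)) = - (W * W) := by
        rw [← e3, Finset.sum_comm, ← Finset.sum_neg_distrib]
        refine Finset.sum_congr rfl fun i _ => ?_
        rw [← Finset.sum_neg_distrib]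
        refine Finset.sum_congr rfl fun j _ => ?_
        rw [← TensorProduct.tmul_neg,
          eq_neg_of_add_eq_zero_left (ExteriorAlgebra.ι_add_mul_swap (X j) (X i))]
      simp only [hK, Matrix.cons_val_zero, Matrix.cons_val_one, TensorProduct.add_tmul,
        TensorProduct.sub_tmul, ← TensorProduct.smul_tmul', Finset.sum_add_distrib,
        Finset.sum_sub_distrib, ← Finset.smul_sum] at e1 e2 e3 e4 ⊢
      rw [e1, e2, e3, e4]
      module
    rw [grassmann, ← Equiv.sum_comp (finTwoArrowEquiv _).symm, Fintype.sum_prod_type]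
    have e5 : ∀ i j : Fin (2 * m + 1 + 1),
        K (v ∘ (finTwoArrowEquiv _).symm (i, j)) ⊗ₜ[ℝ]
          ExteriorAlgebra.ιMulti ℝ 2 (X ∘ (finTwoArrowEquiv _).symm (i, j)) =
        K ![v i, v j] ⊗ₜ[ℝ] (ExteriorAlgebra.ι ℝ (X i) * ExteriorAlgebra.ι ℝ (X j)) := by
      intro i j
      congr 1
      · congr 1
        ext a; fin_cases a <;> rfl
      · simp [ExteriorAlgebra.ιMulti_apply, Matrix.vecTail]
    simp only [e5, key]
    rw [smul_smul]
    norm_num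
  rw [hKd, pow_succ_mul_add_smul_sq d W s hdd hdW]
  -- Degree `2 * m + 2` exceeds the number of vectors in `w`, so only the term linear in `d`
  -- remains.
  have hz : W ^ (2 * (m + 1)) = 0 := by
    rw [hW, ← grassmann_wedgePow]
    exact grassmann_of_lt _ _ _ (by simp; omega)
  rw [hz, smul_zero, zero_add, hW, ← grassmann_wedgePow, ← grassmann_castDeg w Y h2,
    grassmann_top, hd, Algebra.TensorProduct.tmul_mul_tmul, one_mul, ← TensorProduct.smul_tmul']
  congr 2
  exact (ExteriorAlgebra.ιMulti_succ_apply X).symm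

end Grassmann

/-! ### Smoothness of families of alternating maps -/

section Smooth

variable {P E F : Type*} [NormedAddCommGroup P] [NormedSpace ℝ P]
  [NormedAddCommGroup E] [NormedSpace ℝ E] [NormedAddCommGroup F] [NormedSpace ℝ F]

/-- An alternating map depends linearly on its values on tuples of basis vectors, so smoothness can
be tested on fixed arguments. -/
theorem contDiffWithinAt_alt [FiniteDimensional ℝ E] [FiniteDimensional ℝ F] {k : ℕ}
    {r : WithTop ℕ∞} {f : P → Alt E F k} {s : Set P} {x : P}
    (h : ∀ v, ContDiffWithinAt ℝ r (fun y => f y v) s x) : ContDiffWithinAt ℝ r f s x := by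
  let b := Module.finBasis ℝ E
  let ev : Alt E F k →ₗ[ℝ] ((Fin k → Fin (Module.finrank ℝ E)) → F) :=
    { toFun := fun g I => g (fun i => b (I i))
      map_add' := fun _ _ => rfl
      map_smul' := fun _ _ => rfl }
  have hev : Function.Injective ev := by
    intro g g' hg
    apply ContinuousAlternatingMap.toAlternatingMap_injective
    exact Module.Basis.ext_alternating b fun I _ => congrFun hg I
  obtain ⟨g, hg⟩ := ev.exists_leftInverse_of_injective (LinearMap.ker_eq_bot.2 hev)
  have hf : f = fun y => g.toContinuousLinearMap (fun I => f y (fun i => b (I i))) := by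
    funext y
    exact (LinearMap.congr_fun hg (f y)).symm
  rw [hf]
  exact g.toContinuousLinearMap.contDiff.contDiffAt.comp_contDiffWithinAt x
    (contDiffWithinAt_pi.2 fun I => h _)

end Smooth

/-! ### The curvature -/

instance (n : ℕ) : CompleteSpace (Mat n) := FiniteDimensional.complete ℂ (Mat n)

instance (n : ℕ) : FiniteDimensional ℝ (Mat n) := FiniteDimensional.complexToReal (Mat n)

/-- The linear part of `bary`. -/
def baryLin (q : ℕ) : (Fin q → ℝ) →L[ℝ] (Fin (q + 1) → ℝ) :=
  ContinuousLinearMap.pi (Fin.cons (-∑ i, ContinuousLinearMap.proj i)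
    (fun i => ContinuousLinearMap.proj i))

theorem baryLin_apply {q : ℕ} (u : Fin q → ℝ) :
    baryLin q u = (Fin.cons (-∑ i, u i) u : Fin (q + 1) → ℝ) := by
  ext i
  refine Fin.cases ?_ (fun i => ?_) i <;> simp [baryLin]

theorem bary_eq {q : ℕ} (t : Fin q → ℝ) :
    bary t = (Fin.cons 1 0 : Fin (q + 1) → ℝ) + baryLin q t := by
  rw [baryLin_apply]
  ext i
  refine Fin.cases ?_ (fun i => ?_) i <;> simp [bary, sub_eq_add_neg]

theorem sum_bary {q : ℕ} (t : Fin q → ℝ) : ∑ i, bary t i = 1 := by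
  simp [bary, Fin.sum_univ_succ]

theorem sum_baryLin {q : ℕ} (u : Fin q → ℝ) : ∑ i, baryLin q u i = 0 := by
  simp [baryLin_apply, Fin.sum_univ_succ]

theorem hasFDerivAt_bary {q : ℕ} (t : Fin q → ℝ) : HasFDerivAt bary (baryLin q) t := by
  have h : (bary : (Fin q → ℝ) → _) = fun t => (Fin.cons 1 0 : Fin (q + 1) → ℝ) + baryLin q t :=
    funext bary_eq
  rw [h]
  exact (baryLin q).hasFDerivAt.const_add _

theorem contDiff_bary {q : ℕ} {r : WithTop ℕ∞} : ContDiff ℝ r (bary : (Fin q → ℝ) → _) := by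
  have h : (bary : (Fin q → ℝ) → _) = fun t => (Fin.cons 1 0 : Fin (q + 1) → ℝ) + baryLin q t :=
    funext bary_eq
  rw [h]
  exact contDiff_const.add (baryLin q).contDiff

theorem maurerCartan_apply (n : ℕ) (g : Mat n) (v : Fin 1 → Mat n) :
    maurerCartan n g v = Ring.inverse g * v 0 := rfl

theorem hasFDerivAt_snd_apply {V F : Type*} [NormedAddCommGroup V] [NormedSpace ℝ V]
    [NormedAddCommGroup F] [NormedSpace ℝ F] {ι : Type*} [Fintype ι] (i : ι) (x : V × (ι → F)) :
    HasFDerivAt (fun y : V × (ι → F) => y.2 i)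
      ((ContinuousLinearMap.proj (R := ℝ) (φ := fun _ : ι => F) i).comp
        (ContinuousLinearMap.snd ℝ V (ι → F))) x :=
  ((ContinuousLinearMap.proj (R := ℝ) (φ := fun _ : ι => F) i).comp
    (ContinuousLinearMap.snd ℝ V (ι → F))).hasFDerivAt

theorem thetaAt_apply (n q : ℕ) (i : Fin (q + 1)) (x : (Fin q → ℝ) × (Fin (q + 1) → Mat n))
    (v : Fin 1 → (Fin q → ℝ) × (Fin (q + 1) → Mat n)) :
    thetaAt n q i x v = Ring.inverse (x.2 i) * (v 0).2 i := by
  have h := hasFDerivAt_snd_apply i x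
  rw [thetaAt, pullback, ContinuousAlternatingMap.compContinuousLinearMap_apply,
    maurerCartan_apply, h.fderiv]
  rfl

theorem connection_apply (n q : ℕ) (x : (Fin q → ℝ) × (Fin (q + 1) → Mat n))
    (v : Fin 1 → (Fin q → ℝ) × (Fin (q + 1) → Mat n)) :
    connection n q x v = ∑ i, bary x.1 i • (Ring.inverse (x.2 i) * (v 0).2 i) := by
  rw [connection, ContinuousAlternatingMap.sum_apply]
  refine Finset.sum_congr rfl fun i _ => ?_
  rw [ContinuousAlternatingMap.smul_apply, thetaAt_apply]

theorem contDiffAt_inverse_of_isUnit {n : ℕ} {g : Mat n} (hg : IsUnit g) {r : WithTop ℕ∞} :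
    ContDiffAt ℝ r Ring.inverse g := by
  obtain ⟨u, rfl⟩ := hg
  exact contDiffAt_ringInverse ℝ u

theorem differentiableAt_connection (n q : ℕ) (x : (Fin q → ℝ) × (Fin (q + 1) → Mat n))
    (hx : ∀ i, IsUnit (x.2 i)) : DifferentiableAt ℝ (connection n q) x := by
  have h : ContDiffAt ℝ 1 (connection n q) x := by
    rw [← contDiffWithinAt_univ]
    refine contDiffWithinAt_alt fun v => ?_
    simp only [connection_apply]
    refine ContDiffWithinAt.sum fun i _ => ?_
    have h1 : ContDiffAt ℝ 1 (fun y : (Fin q → ℝ) × (Fin (q + 1) → Mat n) => bary y.1 i) x :=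
      ((contDiff_pi.1 contDiff_bary i).comp contDiff_fst).contDiffAt
    have h2 : ContDiffAt ℝ 1 (fun y : (Fin q → ℝ) × (Fin (q + 1) → Mat n) =>
        Ring.inverse (y.2 i)) x :=
      ContDiffAt.comp (g := Ring.inverse) x (contDiffAt_inverse_of_isUnit (hx i))
        (contDiff_pi.1 contDiff_snd i).contDiffAt
    exact (h1.smul (h2.mul contDiffAt_const)).contDiffWithinAt
  exact h.differentiableAt one_ne_zero

theorem hasFDerivAt_connection_apply (n q : ℕ) (x : (Fin q → ℝ) × (Fin (q + 1) → Mat n))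
    (hx : ∀ i, IsUnit (x.2 i)) (v : Fin 1 → (Fin q → ℝ) × (Fin (q + 1) → Mat n))
    (u : (Fin q → ℝ) × (Fin (q + 1) → Mat n)) :
    fderiv ℝ (fun y => connection n q y v) x u =
      ∑ i, (baryLin q u.1 i • (Ring.inverse (x.2 i) * (v 0).2 i) -
        bary x.1 i • (Ring.inverse (x.2 i) * u.2 i * (Ring.inverse (x.2 i) * (v 0).2 i))) := by
  simp only [connection_apply]
  choose g hg using hx
  have h1 : ∀ i, HasFDerivAt (fun y : (Fin q → ℝ) × (Fin (q + 1) → Mat n) => bary y.1 i)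
      (((ContinuousLinearMap.proj i).comp (baryLin q)).comp (ContinuousLinearMap.fst ℝ _ _)) x :=
    fun i => (hasFDerivAt_pi'.1 (hasFDerivAt_bary x.1) i).comp x hasFDerivAt_fst
  have h2 : ∀ i, HasFDerivAt (fun y : (Fin q → ℝ) × (Fin (q + 1) → Mat n) => Ring.inverse (y.2 i))
      _ x := fun i =>
    HasFDerivAt.comp (g := Ring.inverse) x (by rw [← hg i]; exact hasFDerivAt_ringInverse (𝕜 := ℝ) (g i)) (hasFDerivAt_snd_apply i x)
  have h3 := HasFDerivAt.fun_sum (u := Finset.univ) fun i _ =>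
    (h1 i).fun_smul ((h2 i).mul_const' ((v 0).2 i))
  rw [h3.fderiv, sum_apply]
  refine Finset.sum_congr rfl fun i _ => ?_
  simp [← hg i, mul_assoc, add_comm, sub_eq_add_neg]

/-- The value of the curvature on two tangent vectors as a function of the barycentric coordinates
`t`, their differentials `τ`, and the values `a` of the Maurer-Cartan forms. -/
def curvForm {ι A : Type*} [Fintype ι] [Ring A] [Algebra ℝ A] (t : ι → ℝ) (τ : Fin 2 → ι → ℝ)
    (a : Fin 2 → ι → A) : A :=
  ∑ i, (τ 0 i • a 1 i - τ 1 i • a 0 i) - ∑ i, t i • (a 0 i * a 1 i - a 1 i * a 0 i) +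
    ((∑ i, t i • a 0 i) * (∑ i, t i • a 1 i) - (∑ i, t i • a 1 i) * (∑ i, t i • a 0 i))

/-- The term `-∑ t_i [a_i, a_i]` comes from `d(g⁻¹) = -g⁻¹ dg g⁻¹`. The factor `1/2` cancels the
doubling in `[θ, θ] = 2 θ ∧ θ`. -/
theorem curvature_apply (n q : ℕ) (x : (Fin q → ℝ) × (Fin (q + 1) → Mat n))
    (hx : ∀ i, IsUnit (x.2 i)) (v : Fin 2 → (Fin q → ℝ) × (Fin (q + 1) → Mat n)) :
    curvature n q x v = curvForm (bary x.1) (fun k => baryLin q (v k).1)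
      (fun k i => Ring.inverse (x.2 i) * (v k).2 i) := by
  have h1 : extDeriv (connection n q) x v =
      fderiv ℝ (fun y => connection n q y (fun _ => v 1)) x (v 0) -
        fderiv ℝ (fun y => connection n q y (fun _ => v 0)) x (v 1) := by
    have h := extDeriv_apply (differentiableAt_connection n q x hx) v
    rw [Fin.sum_univ_two] at h
    have e0 : Fin.removeNth 0 v = fun _ => v 1 := by
      funext i; fin_cases i; rfl
    have e1 : Fin.removeNth 1 v = fun _ => v 0 := by
      funext i; fin_cases i; rfl
    rw [e0, e1] at h
    rw [h]
    simp [sub_eq_add_neg]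
  have h2 : bracket (connection n q x) (connection n q x) v = (2 : ℝ) •
      (connection n q x (fun _ => v 0) * connection n q x (fun _ => v 1) -
        connection n q x (fun _ => v 1) * connection n q x (fun _ => v 0)) := by
    rw [bracket, two_smul]
    have h := wedge_one_one_apply (connection n q x) (connection n q x) v
    rw [← h]
    rfl
  change extDeriv (connection n q) x v +
    (1 / 2 : ℝ) • bracket (connection n q x) (connection n q x) v = _
  rw [h1, h2, hasFDerivAt_connection_apply n q x hx, hasFDerivAt_connection_apply n q x hx,
    connection_apply, connection_apply, smul_smul, curvForm]
  norm_num only [one_smul]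
  congr 1
  rw [← Finset.sum_sub_distrib, ← Finset.sum_sub_distrib]
  refine Finset.sum_congr rfl fun i _ => ?_
  rw [smul_sub]
  abel

/-! ### Algebra of the curvature expression: naturality, translation invariance and faces. -/

section CurvForm

variable {ι A : Type*} [Fintype ι] [Ring A] [Algebra ℝ A]

theorem map_curvForm {B : Type*} [Ring B] [Algebra ℝ B] (φ : A →ₐ[ℝ] B) (t : ι → ℝ)
    (τ : Fin 2 → ι → ℝ) (a : Fin 2 → ι → A) :
    φ (curvForm t τ a) = curvForm t τ (fun k i => φ (a k i)) := by
  simp [curvForm]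

/-- This is why the Chern character form descends. The shift pairs to zero with `τ`, and its
contributions to `∑ t_i [a_i, a_i]` and to the bracket of the averages cancel because the weights
sum to one. -/
theorem curvForm_add_const (t : ι → ℝ) (τ : Fin 2 → ι → ℝ) (a : Fin 2 → ι → A) (c : Fin 2 → A)
    (ht : ∑ i, t i = 1) (hτ : ∀ k, ∑ i, τ k i = 0) :
    curvForm t τ (fun k i => a k i + c k) = curvForm t τ a := by
  have h1 : ∀ k l, ∑ i, τ k i • (a l i + c l) = ∑ i, τ k i • a l i := by
    intro k l
    simp only [smul_add, Finset.sum_add_distrib, ← Finset.sum_smul, hτ, zero_smul, add_zero]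
  have h2 : ∀ k, ∑ i, t i • (a k i + c k) = ∑ i, t i • a k i + c k := by
    intro k
    simp only [smul_add, Finset.sum_add_distrib, ← Finset.sum_smul, ht, one_smul]
  have h3 : ∀ k l, ∑ i, t i • ((a k i + c k) * (a l i + c l)) = ∑ i, t i • (a k i * a l i) +
      (∑ i, t i • a k i) * c l + c k * (∑ i, t i • a l i) + c k * c l := by
    intro k l
    simp only [mul_add, add_mul, smul_add, Finset.sum_add_distrib, ← Finset.sum_smul, ht,
      one_smul, Finset.sum_mul, Finset.mul_sum, smul_mul_assoc, mul_smul_comm]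
    abel
  simp only [curvForm, smul_sub, Finset.sum_sub_distrib, h1, h2, h3]
  noncomm_ring

theorem curvForm_face {q : ℕ} (i : Fin (q + 1)) (t : Fin (q + 1) → ℝ) (τ : Fin 2 → Fin (q + 1) → ℝ)
    (a : Fin 2 → Fin (q + 1) → A) (ht : t i = 0) (hτ : ∀ k, τ k i = 0) :
    curvForm t τ a = curvForm (t ∘ i.succAbove) (fun k => τ k ∘ i.succAbove)
      (fun k => a k ∘ i.succAbove) := by
  simp [curvForm, Fin.sum_univ_succAbove _ i, ht, hτ]

end CurvForm

/-! ### Pullbacks and the Chern character form -/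

section Pullback

variable {E E' E'' F : Type*} [NormedAddCommGroup E] [NormedSpace ℝ E] [NormedAddCommGroup E']
  [NormedSpace ℝ E'] [NormedAddCommGroup E''] [NormedSpace ℝ E''] [NormedAddCommGroup F]
  [NormedSpace ℝ F] {k : ℕ}

theorem pullback_apply (f : E → E') (w : DForm E' F k) (x : E) (v : Fin k → E) :
    pullback f w x v = w (f x) (fun i => fderiv ℝ f x (v i)) := rfl

theorem pullback_pullback {f : E → E'} {g : E' → E''} (w : DForm E'' F k) {x : E}
    (hg : DifferentiableAt ℝ g (f x)) (hf : DifferentiableAt ℝ f x) :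
    pullback f (pullback g w) x = pullback (g ∘ f) w x := by
  ext v
  simp only [pullback_apply, fderiv_comp x hg hf]
  rfl

theorem pullback_congr (f : E → E') {w w' : DForm E' F k} {x : E} (h : w (f x) = w' (f x)) :
    pullback f w x = pullback f w' x := by
  rw [pullback, pullback, h]

theorem pullback_eq_of_eventuallyEq {f g : E → E'} (w : DForm E' F k) {x : E}
    (h : f =ᶠ[nhds x] g) : pullback f w x = pullback g w x := by
  rw [pullback, pullback, h.fderiv_eq, h.eq_of_nhds]

theorem pullback_id (w : DForm E F k) (x : E) : pullback id w x = w x := by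
  ext v
  rw [pullback_apply, fderiv_id]
  rfl

end Pullback

/-- Conjugation `a ↦ u⁻¹ a u` by a unit. -/
def conjAlgHom {A : Type*} [Ring A] [Algebra ℝ A] (u : Aˣ) : A →ₐ[ℝ] A where
  toFun a := ↑u⁻¹ * a * u
  map_one' := by simp
  map_mul' a b := by simp [mul_assoc]
  map_zero' := by simp
  map_add' a b := by simp [mul_add, add_mul]
  commutes' r := by
    rw [mul_assoc, Algebra.commutes, ← mul_assoc]
    simp

theorem conjAlgHom_apply {A : Type*} [Ring A] [Algebra ℝ A] (u : Aˣ) (a : A) :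
    conjAlgHom u a = ↑u⁻¹ * a * u := rfl

theorem matTrace_conjAlgHom {n : ℕ} (u : (Mat n)ˣ) (a : Mat n) :
    matTrace n (conjAlgHom u a) = matTrace n a := by
  have h : ∀ b c : Mat n, matTrace n (b * c) = matTrace n (c * b) := fun b c =>
    Matrix.trace_mul_comm (R := ℂ) b c
  rw [conjAlgHom_apply, h, ← mul_assoc, Units.mul_inv, one_mul]

theorem chernCharacterForm_apply (n p q : ℕ) (x : (Fin q → ℝ) × (Fin (q + 1) → Mat n))
    (v : Fin (2 * p) → (Fin q → ℝ) × (Fin (q + 1) → Mat n)) :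
    chernCharacterForm n p q x v = (1 / (p.factorial : ℂ) *
      (-1 / (2 * Real.pi * Complex.I) : ℂ) ^ p) *
      matTrace n (wedgePow (curvature n q x) p (fun i => v (Fin.cast (Nat.mul_comm p 2) i))) := by
  have h : ∀ (c : ℂ) (a : Mat n), matTrace n (c • a) = c * matTrace n a := fun c a =>
    Matrix.trace_smul (R := ℂ) c a
  have h2 : chernCharacterForm n p q x v = (1 / (p.factorial : ℂ)) *
      matTrace n (castDeg (Nat.mul_comm p 2)
      (wedgePow ((-1 / (2 * Real.pi * Complex.I) : ℂ) • curvature n q x) p) v) := rfl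
  rw [h2, wedgePow_smul, castDeg_apply, ContinuousAlternatingMap.smul_apply, h,
    ← mul_assoc (1 / (p.factorial : ℂ))]

/-- The pullbacks of two Chern character forms agree if the pulled back curvatures are
conjugate. -/
theorem chernCharacterForm_congr {E : Type*} [NormedAddCommGroup E] [NormedSpace ℝ E]
    (n p q q' : ℕ) (x : (Fin q → ℝ) × (Fin (q + 1) → Mat n))
    (x' : (Fin q' → ℝ) × (Fin (q' + 1) → Mat n))
    (L : E →L[ℝ] (Fin q → ℝ) × (Fin (q + 1) → Mat n))
    (L' : E →L[ℝ] (Fin q' → ℝ) × (Fin (q' + 1) → Mat n)) (u : (Mat n)ˣ)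
    (h : ∀ v : Fin 2 → E, curvature n q' x' (L' ∘ v) = conjAlgHom u (curvature n q x (L ∘ v))) :
    (chernCharacterForm n p q' x').compContinuousLinearMap L' =
      (chernCharacterForm n p q x).compContinuousLinearMap L := by
  ext v
  rw [ContinuousAlternatingMap.compContinuousLinearMap_apply,
    ContinuousAlternatingMap.compContinuousLinearMap_apply, chernCharacterForm_apply,
    chernCharacterForm_apply]
  congr 1
  -- Conjugation passes through the wedge power by `h1`, while `h2` and `h3` move `L` and `L'` onto
  -- the arguments. The trace then removes the conjugation.
  have h1 := wedgePow_map (f := (curvature n q x).compContinuousLinearMap L)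
    (f' := (curvature n q' x').compContinuousLinearMap L') (conjAlgHom u) id h p
    (fun i => v (Fin.cast (Nat.mul_comm p 2) i))
  have h2 := wedgePow_map (f := curvature n q x)
    (f' := (curvature n q x).compContinuousLinearMap L) (AlgHom.id ℝ (Mat n)) L (fun _ => rfl) p
    (fun i => v (Fin.cast (Nat.mul_comm p 2) i))
  have h3 := wedgePow_map (f := curvature n q' x')
    (f' := (curvature n q' x').compContinuousLinearMap L') (AlgHom.id ℝ (Mat n)) L'
    (fun _ => rfl) p (fun i => v (Fin.cast (Nat.mul_comm p 2) i))
  have h4 := h3.symm.trans (h1.trans (congrArg (conjAlgHom u) h2))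
  exact (congrArg (matTrace n) h4).trans (matTrace_conjAlgHom u _)

/-- Gauge invariance of the Chern character form. -/
theorem pullback_chernCharacterForm_gauge {E : Type*} [NormedAddCommGroup E] [NormedSpace ℝ E]
    (n p q : ℕ) {T : E → Fin q → ℝ} {G G' : E → Fin (q + 1) → Mat n} {U : E → Mat n} {z : E}
    (hT : DifferentiableAt ℝ T z) (hG : DifferentiableAt ℝ G z) (hU : DifferentiableAt ℝ U z)
    (hGu : ∀ i, IsUnit (G z i)) (hUu : IsUnit (U z))
    (h : ∀ᶠ y in nhds z, ∀ i, G' y i = G y i * U y) :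
    pullback (fun y => (T y, G' y)) (chernCharacterForm n p q) z =
      pullback (fun y => (T y, G y)) (chernCharacterForm n p q) z := by
  have hGG : (fun y => (T y, G' y)) =ᶠ[nhds z] fun y => (T y, fun i => G y i * U y) :=
    h.mono fun y hy => Prod.ext rfl (funext hy)
  rw [pullback_eq_of_eventuallyEq _ hGG]
  obtain ⟨u, hu⟩ := hUu
  choose g hg using hGu
  refine chernCharacterForm_congr n p q q _ _ _ _ u fun v => ?_
  have hGi := fun i => differentiableAt_pi.1 hG i
  have hGU : HasFDerivAt (fun y => fun i => G y i * U y) _ z :=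
    hasFDerivAt_pi.2 fun i => (hGi i).hasFDerivAt.mul' hU.hasFDerivAt
  have e1 : ∀ w, fderiv ℝ (fun y => (T y, G y)) z w = (fderiv ℝ T z w, fderiv ℝ G z w) := by
    intro w; rw [(hT.hasFDerivAt.prodMk hG.hasFDerivAt).fderiv]; rfl
  have e2 : ∀ w i, (fderiv ℝ (fun y => (T y, fun i => G y i * U y)) z w).2 i =
      G z i * fderiv ℝ U z w + fderiv ℝ G z w i * U z := by
    intro w i
    rw [(hT.hasFDerivAt.prodMk hGU).fderiv]
    have : fderiv ℝ G z w i = fderiv ℝ (fun y => G y i) z w := by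
      rw [fderiv_pi hGi]; rfl
    rw [this]
    rfl
  have e3 : ∀ w, (fderiv ℝ (fun y => (T y, fun i => G y i * U y)) z w).1 = fderiv ℝ T z w := by
    intro w; rw [(hT.hasFDerivAt.prodMk hGU).fderiv]; rfl
  have hu' : ∀ i, IsUnit (G z i * U z) := fun i => by
    rw [← hg i, ← hu]; exact (g i * u).isUnit
  rw [curvature_apply n q (T z, fun i => G z i * U z) hu',
    curvature_apply n q (T z, G z) (fun i => ⟨g i, hg i⟩), map_curvForm]
  simp only [Function.comp_apply, e1, e2, e3]
  -- The shift is `c = u⁻¹ dU`, the inhomogeneous term of `(G U)⁻¹ d(G U) = u⁻¹ (G⁻¹ dG) u + u⁻¹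
  -- dU`.
  rw [← curvForm_add_const _ _ (fun k i => conjAlgHom u _)
    (fun k => ↑u⁻¹ * fderiv ℝ U z (v k)) (sum_bary _) (fun k => sum_baryLin _)]
  congr 1
  funext k i
  rw [conjAlgHom_apply, ← hg i, ← hu, ← Units.val_mul, Ring.inverse_unit, Ring.inverse_unit,
    mul_inv_rev, Units.val_mul, mul_add]
  rw [mul_assoc (↑u⁻¹ : Mat n) (↑(g i)⁻¹ : Mat n) (↑(g i) * _), Units.inv_mul_cancel_left,
    add_comm]
  simp only [mul_assoc]

/-! ### Face maps in barycentric coordinates and compatibility on `N Ḡ`. -/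

theorem bary_simplexFace {q : ℕ} (i : Fin (q + 2)) (t : Fin q → ℝ) :
    bary (simplexFace i t) = (i.insertNth (0 : ℝ) (bary t) : Fin (q + 2) → ℝ) := by
  -- `bary` recomputes the zeroth coordinate as one minus the rest, so the total of the inserted
  -- tuple is needed.
  have h : ∑ j, (i.insertNth (0 : ℝ) (bary t) : Fin (q + 2) → ℝ) j = 1 := by
    rw [Fin.sum_univ_succAbove _ i]
    simp [sum_bary]
  rw [Fin.sum_univ_succ] at h
  funext j
  refine Fin.cases ?_ (fun j => rfl) j
  simp only [bary, Fin.cons_zero, simplexFace] at h ⊢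
  linarith

/-- The linear part of `simplexFace i`. -/
def simplexFaceLin {q : ℕ} (i : Fin (q + 2)) : (Fin q → ℝ) →L[ℝ] (Fin (q + 1) → ℝ) :=
  ContinuousLinearMap.pi fun j =>
    (i.insertNth (0 : (Fin q → ℝ) →L[ℝ] ℝ)
      (fun l => (ContinuousLinearMap.proj l).comp (baryLin q)) :
        Fin (q + 2) → ((Fin q → ℝ) →L[ℝ] ℝ)) j.succ

theorem simplexFaceLin_apply {q : ℕ} (i : Fin (q + 2)) (u : Fin q → ℝ) (j : Fin (q + 1)) :
    simplexFaceLin i u j = (i.insertNth (0 : ℝ) (baryLin q u) : Fin (q + 2) → ℝ) j.succ := by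
  rw [simplexFaceLin, ContinuousLinearMap.pi_apply]
  refine Fin.succAboveCases i ?_ (fun l => ?_) j.succ <;> simp

theorem hasFDerivAt_simplexFace {q : ℕ} (i : Fin (q + 2)) (t : Fin q → ℝ) :
    HasFDerivAt (simplexFace i) (simplexFaceLin i) t := by
  refine hasFDerivAt_pi.2 fun j => ?_
  simp only [simplexFace]
  refine Fin.succAboveCases i ?_ (fun l => ?_) j.succ
  · simpa using hasFDerivAt_const _ _
  · simpa using hasFDerivAt_pi'.1 (hasFDerivAt_bary t) l

theorem baryLin_simplexFaceLin {q : ℕ} (i : Fin (q + 2)) (u : Fin q → ℝ) :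
    baryLin (q + 1) (simplexFaceLin i u) =
      (i.insertNth (0 : ℝ) (baryLin q u) : Fin (q + 2) → ℝ) := by
  have h : ∑ j, (i.insertNth (0 : ℝ) (baryLin q u) : Fin (q + 2) → ℝ) j = 0 := by
    rw [Fin.sum_univ_succAbove _ i]
    simp [sum_baryLin]
  rw [Fin.sum_univ_succ] at h
  funext j
  rw [baryLin_apply]
  refine Fin.cases ?_ (fun j => ?_) j
  · simp only [Fin.cons_zero, simplexFaceLin_apply]
    linarith
  · simp only [Fin.cons_succ, simplexFaceLin_apply]

/-- The Chern character forms on `N Ḡ` are compatible with the face operators. -/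
theorem pullback_chernCharacterForm_face (n p q : ℕ) (i : Fin (q + 2))
    (x : (Fin q → ℝ) × (Fin (q + 2) → Mat n)) (hx : ∀ j, IsUnit (x.2 j)) :
    pullback (Prod.map (simplexFace i) id) (chernCharacterForm n p (q + 1)) x =
      pullback (Prod.map id (fun g => g ∘ i.succAbove)) (chernCharacterForm n p q) x := by
  -- Upstairs the two pulled back curvatures agree exactly, so the conjugating unit is `1`: the
  -- vertex `i` has `t_i = 0` and `dt_i = 0` and drops out.
  refine chernCharacterForm_congr n p q (q + 1) _ _ _ _ 1 fun v => ?_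
  have e1 : HasFDerivAt (Prod.map (simplexFace i) (id : (Fin (q + 2) → Mat n) → _)) _ x :=
    HasFDerivAt.prodMap x (hasFDerivAt_simplexFace i x.1) (hasFDerivAt_id x.2)
  let D : (Fin (q + 2) → Mat n) →L[ℝ] (Fin (q + 1) → Mat n) :=
    ContinuousLinearMap.pi fun j => ContinuousLinearMap.proj (i.succAbove j)
  have e2 : HasFDerivAt (Prod.map (id : (Fin q → ℝ) → _)
      (fun g : Fin (q + 2) → Mat n => g ∘ i.succAbove)) _ x :=
    HasFDerivAt.prodMap x (hasFDerivAt_id x.1) (show HasFDerivAt _ D x.2 from D.hasFDerivAt)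
  rw [e1.fderiv, e2.fderiv, curvature_apply n (q + 1) _ hx, curvature_apply n q _ (fun j => hx _),
    conjAlgHom_apply]
  simp only [inv_one, Units.val_one, one_mul, mul_one, Function.comp_apply, Prod.map,
    bary_simplexFace]
  have e3 : ∀ w : (Fin q → ℝ) × (Fin (q + 2) → Mat n), baryLin (q + 1)
      ((simplexFaceLin i).prodMap (ContinuousLinearMap.id ℝ (Fin (q + 2) → Mat n)) w).1 =
      (i.insertNth (0 : ℝ) (baryLin q w.1) : Fin (q + 2) → ℝ) := fun w =>
    baryLin_simplexFaceLin i w.1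
  simp only [e3]
  rw [curvForm_face i _ _ _ (by simp) (by simp)]
  congr 1
  · funext j; simp
  · funext k j; simp

section

/-! ### A section of `N Ḡ → N G` -/

/-- The section `(h₁, …, h_q) ↦ (h₁ ⋯ h_q, h₂ ⋯ h_q, …, h_q, 1)` of `γ`. -/
def gammaSection (n q : ℕ) (h : Fin q → Mat n) : Fin (q + 1) → Mat n :=
  fun j => ((List.ofFn h).drop j).prod

variable {n q : ℕ}

theorem gammaSection_last (h : Fin q → Mat n) : gammaSection n q h (Fin.last q) = 1 := by
  simp [gammaSection, List.drop_of_length_le]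

theorem gammaSection_castSucc (h : Fin q → Mat n) (j : Fin q) :
    gammaSection n q h j.castSucc = h j * gammaSection n q h j.succ := by
  rw [gammaSection, gammaSection, Fin.val_castSucc, List.drop_eq_getElem_cons (by simp)]
  simp

theorem isUnit_gammaSection {h : Fin q → Mat n} (hh : h ∈ NG n q) :
    gammaSection n q h ∈ NGbar n q := by
  intro j
  induction j using Fin.reverseInduction with
  | last => rw [gammaSection_last]; exact isUnit_one
  | cast j ih => rw [gammaSection_castSucc]; exact (hh j).mul ih

theorem contDiff_gammaSection {r : WithTop ℕ∞} : ContDiff ℝ r (gammaSection n q) := by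
  refine contDiff_pi.2 fun j => ?_
  induction j using Fin.reverseInduction with
  | last => simp only [gammaSection_last]; exact contDiff_const
  | cast j ih =>
    simp only [gammaSection_castSucc]
    exact (contDiff_apply ℝ (Mat n) j).mul ih

theorem gammaMap_gammaSection {h : Fin q → Mat n} (hh : h ∈ NG n q) :
    gammaMap n q (gammaSection n q h) = h := by
  funext j
  rw [gammaMap, gammaSection_castSucc, mul_assoc,
    Ring.mul_inverse_cancel _ (isUnit_gammaSection hh j.succ), mul_one]

/-- The products `g_j g_{j+1}⁻¹ ⋯ g_{q-1} g_q⁻¹` telescope. -/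
theorem gammaSection_gammaMap {g : Fin (q + 1) → Mat n} (hg : g ∈ NGbar n q) (j : Fin (q + 1)) :
    gammaSection n q (gammaMap n q g) j = g j * Ring.inverse (g (Fin.last q)) := by
  induction j using Fin.reverseInduction with
  | last => rw [gammaSection_last, Ring.mul_inverse_cancel _ (hg _)]
  | cast j ih =>
    rw [gammaSection_castSucc, ih, gammaMap, mul_assoc, ← mul_assoc (Ring.inverse _) (g j.succ),
      Ring.inverse_mul_cancel _ (hg _), one_mul]

/-- The right factor is `1` for every face except the last, which deletes the final entry `1` of the
section. There it is the last component of `h`, and the section must be renormalized by it. -/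
theorem gammaSection_faceNG (i : Fin (q + 2)) (h : Fin (q + 1) → Mat n) (j : Fin (q + 1)) :
    gammaSection n (q + 1) h (i.succAbove j) = gammaSection n q (faceNG n q i h) j *
      gammaSection n (q + 1) h (i.succAbove (Fin.last q)) := by
  induction j using Fin.reverseInduction with
  | last => rw [gammaSection_last, one_mul]
  | cast j ih =>
    rw [gammaSection_castSucc, mul_assoc, ← ih, faceNG]
    rcases lt_trichotomy ((j : ℕ) + 1) i with hlt | heq | hgt
    · have e1 : i.succAbove j.castSucc = j.castSucc.castSucc :=
        Fin.succAbove_of_castSucc_lt _ _ (by simp [Fin.lt_def]; omega)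
      have e2 : i.succAbove j.succ = j.castSucc.succ :=
        Fin.succAbove_of_castSucc_lt _ _ (by simp [Fin.lt_def]; omega)
      rw [if_pos hlt, e1, e2, gammaSection_castSucc]
    · have e1 : i.succAbove j.castSucc = j.castSucc.castSucc :=
        Fin.succAbove_of_castSucc_lt _ _ (by simp [Fin.lt_def]; omega)
      have e2 : i.succAbove j.succ = j.succ.succ :=
        Fin.succAbove_of_le_castSucc _ _ (by simp [Fin.le_def]; omega)
      rw [if_neg (by omega), if_pos heq, e1, e2, gammaSection_castSucc, mul_assoc]
      exact congrArg _ (gammaSection_castSucc h j.succ)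
    · have e1 : i.succAbove j.castSucc = j.succ.castSucc :=
        Fin.succAbove_of_le_castSucc _ _ (by simp [Fin.le_def]; omega)
      have e2 : i.succAbove j.succ = j.succ.succ :=
        Fin.succAbove_of_le_castSucc _ _ (by simp [Fin.le_def]; omega)
      rw [if_neg (by omega), if_neg (by omega), e1, e2, gammaSection_castSucc]

theorem faceNG_mem (i : Fin (q + 2)) {h : Fin (q + 1) → Mat n} (hh : h ∈ NG n (q + 1)) :
    faceNG n q i h ∈ NG n q := by
  intro j
  rw [faceNG]
  split_ifs
  exacts [hh _, (hh _).mul (hh _), hh _]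

theorem differentiable_faceNG (i : Fin (q + 2)) : Differentiable ℝ (faceNG n q i) := by
  refine differentiable_pi.2 fun j => ?_
  simp only [faceNG]
  split_ifs <;> fun_prop

theorem differentiable_prodMap {E E' F F' : Type*} [NormedAddCommGroup E] [NormedSpace ℝ E]
    [NormedAddCommGroup E'] [NormedSpace ℝ E'] [NormedAddCommGroup F] [NormedSpace ℝ F]
    [NormedAddCommGroup F'] [NormedSpace ℝ F'] {f : E → F} {g : E' → F'}
    (hf : Differentiable ℝ f) (hg : Differentiable ℝ g) : Differentiable ℝ (Prod.map f g) :=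
  fun x => DifferentiableAt.prodMap x (hf x.1) (hg x.2)

theorem isOpen_NG : IsOpen (NG n q) := by
  have h : NG n q = ⋂ i, (fun h : Fin q → Mat n => h i) ⁻¹' {a | IsUnit a} := by
    ext h; simp [NG]
  rw [h]
  exact isOpen_iInter_of_finite fun i =>
    (Units.isOpen (R := Mat n)).preimage (continuous_apply i)

theorem isOpen_NGbar : IsOpen (NGbar n q) := isOpen_NG

theorem differentiableAt_inverse_apply {g : Fin (q + 1) → Mat n} (i : Fin (q + 1))
    (hg : IsUnit (g i)) :
    DifferentiableAt ℝ (fun g : Fin (q + 1) → Mat n => Ring.inverse (g i)) g :=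
  DifferentiableAt.comp (g := Ring.inverse) g
    ((contDiffAt_inverse_of_isUnit hg).differentiableAt one_ne_zero)
    (differentiableAt_apply i g)

theorem differentiableAt_gammaMap {g : Fin (q + 1) → Mat n} (hg : g ∈ NGbar n q) :
    DifferentiableAt ℝ (gammaMap n q) g :=
  differentiableAt_pi.2 fun j => (differentiableAt_apply j.castSucc g).mul
    (differentiableAt_inverse_apply j.succ (hg _))

/-! ### The simplicial Chern character form -/

/-- The descent of `ch_p(Ω)` to `Δ^q × N G (q)`, as the pullback by the section of `γ`. -/
def chernCharacterDescent (n p q : ℕ) : DForm ((Fin q → ℝ) × (Fin q → Mat n)) ℂ (2 * p) :=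
  pullback (Prod.map id (gammaSection n q)) (chernCharacterForm n p q)

/-- Here `σ ∘ γ` is the gauge transformation with `U = g_q⁻¹`. It has this form only where the `g_i`
are invertible, which is a neighbourhood of the point. -/
theorem pullback_gammaMap_chernCharacterDescent (p : ℕ)
    (x : (Fin q → ℝ) × (Fin (q + 1) → Mat n)) (hx : x.2 ∈ NGbar n q) :
    pullback (Prod.map id (gammaMap n q)) (chernCharacterDescent n p q) x =
      chernCharacterForm n p q x := by
  have h1 : DifferentiableAt ℝ (Prod.map (id : (Fin q → ℝ) → _) (gammaMap n q)) x :=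
    DifferentiableAt.prodMap x differentiableAt_id (differentiableAt_gammaMap hx)
  have h2 : Differentiable ℝ (Prod.map (id : (Fin q → ℝ) → _) (gammaSection n q)) :=
    differentiable_prodMap differentiable_id (contDiff_gammaSection.differentiable one_ne_zero)
  rw [chernCharacterDescent, pullback_pullback _ (h2 _) h1]
  have h3 := pullback_chernCharacterForm_gauge n p q (z := x) (T := fun y => y.1)
    (G := fun y => y.2) (G' := fun y => gammaSection n q (gammaMap n q y.2))
    (U := fun y => Ring.inverse (y.2 (Fin.last q))) differentiableAt_fst differentiableAt_snd
    (DifferentiableAt.comp (g := fun g : Fin (q + 1) → Mat n => Ring.inverse (g (Fin.last q))) x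
      (differentiableAt_inverse_apply _ (hx _)) differentiableAt_snd) hx (hx _).ringInverse
    (Filter.eventually_of_mem ((isOpen_NGbar.preimage continuous_snd).mem_nhds hx)
      fun y hy j => gammaSection_gammaMap hy j)
  exact h3.trans (pullback_id _ x)

/-- The compatibility on `N Ḡ` is pulled back by the section. The mismatch between section and faces
is a right translation, absorbed by gauge invariance. -/
theorem pullback_face_chernCharacterDescent (p : ℕ) (i : Fin (q + 2))
    (x : (Fin q → ℝ) × (Fin (q + 1) → Mat n)) (hx : x.2 ∈ NG n (q + 1)) :
    pullback (Prod.map (simplexFace i) id) (chernCharacterDescent n p (q + 1)) x =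
      pullback (Prod.map id (faceNG n q i)) (chernCharacterDescent n p q) x := by
  have hs : ∀ m, Differentiable ℝ (gammaSection n m) := fun m =>
    contDiff_gammaSection.differentiable one_ne_zero
  have hs' : ∀ m, Differentiable ℝ (Prod.map (id : (Fin m → ℝ) → _) (gammaSection n m)) :=
    fun m => differentiable_prodMap differentiable_id (hs m)
  have hf : Differentiable ℝ (simplexFace i) := fun t =>
    (hasFDerivAt_simplexFace i t).differentiableAt
  have hd : Differentiable ℝ (fun g : Fin (q + 2) → Mat n => g ∘ i.succAbove) :=
    differentiable_pi.2 fun j => differentiable_apply (i.succAbove j)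
  have hσ : Differentiable ℝ
      (Prod.map (id : (Fin q → ℝ) → _) (gammaSection n (q + 1))) :=
    differentiable_prodMap differentiable_id (hs (q + 1))
  rw [chernCharacterDescent, chernCharacterDescent,
    pullback_pullback _ (hs' _ _) ((differentiable_prodMap hf differentiable_id) x),
    pullback_pullback _ (hs' _ _) ((differentiable_prodMap differentiable_id (differentiable_faceNG i)) x)]
  have h1 := pullback_congr (Prod.map (id : (Fin q → ℝ) → _) (gammaSection n (q + 1))) (x := x)
    (pullback_chernCharacterForm_face n p q i
      (Prod.map id (gammaSection n (q + 1)) x) (isUnit_gammaSection hx))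
  rw [pullback_pullback _ ((differentiable_prodMap hf differentiable_id) _) (hσ x),
    pullback_pullback _ ((differentiable_prodMap differentiable_id hd) _) (hσ x)] at h1
  have hG : DifferentiableAt ℝ (fun y : (Fin q → ℝ) × (Fin (q + 1) → Mat n) =>
      gammaSection n q (faceNG n q i y.2)) x :=
    DifferentiableAt.comp (g := fun h => gammaSection n q (faceNG n q i h)) x
      (((hs q).comp (differentiable_faceNG i)) x.2) differentiableAt_snd
  have hU : DifferentiableAt ℝ (fun y : (Fin q → ℝ) × (Fin (q + 1) → Mat n) =>
      gammaSection n (q + 1) y.2 (i.succAbove (Fin.last q))) x :=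
    DifferentiableAt.comp (g := fun h => gammaSection n (q + 1) h (i.succAbove (Fin.last q))) x
      (differentiable_pi.1 (hs (q + 1)) _ x.2) differentiableAt_snd
  have hGu : ∀ j, IsUnit (gammaSection n q (faceNG n q i x.2) j) :=
    isUnit_gammaSection (faceNG_mem i hx)
  have h2 : pullback (fun y : (Fin q → ℝ) × (Fin (q + 1) → Mat n) =>
        (y.1, fun j => gammaSection n (q + 1) y.2 (i.succAbove j)))
        (chernCharacterForm n p q) x =
      pullback (fun y => (y.1, gammaSection n q (faceNG n q i y.2)))
        (chernCharacterForm n p q) x :=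
    pullback_chernCharacterForm_gauge n p q differentiableAt_fst hG hU hGu
      (isUnit_gammaSection hx _)
      (Filter.Eventually.of_forall fun y j => gammaSection_faceNG i y.2 j)
  exact h1.trans h2

/-! ### Smoothness, existence and uniqueness of the descended form. -/

section Smooth

variable {P E A : Type*} [NormedAddCommGroup P] [NormedSpace ℝ P]
  [NormedAddCommGroup E] [NormedSpace ℝ E] [NormedRing A] [NormedAlgebra ℝ A]
  {r : WithTop ℕ∞} {s : Set P}

theorem contDiffOn_wedgePow_apply {d : ℕ} {f : P → Alt E A d}
    (hf : ∀ v, ContDiffOn ℝ r (fun x => f x v) s) (m : ℕ) (v : Fin (m * d) → E) :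
    ContDiffOn ℝ r (fun x => wedgePow (f x) m v) s := by
  induction m with
  | zero => simp only [wedgePow]; exact contDiffOn_const
  | succ m ih =>
    simp only [wedgePow, castDeg_apply, wedge_apply]
    refine ContDiffOn.const_smul _ (ContDiffOn.sum fun σ _ => ?_)
    simp only [Units.smul_def, ← Int.cast_smul_eq_zsmul ℝ]
    exact ((ih _).mul (hf _)).const_smul _

theorem contDiffOn_curvForm {ι : Type*} [Fintype ι] {t : P → ι → ℝ} {τ : P → Fin 2 → ι → ℝ}
    {a : P → Fin 2 → ι → A} (ht : ∀ i, ContDiffOn ℝ r (fun x => t x i) s)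
    (hτ : ∀ k i, ContDiffOn ℝ r (fun x => τ x k i) s)
    (ha : ∀ k i, ContDiffOn ℝ r (fun x => a x k i) s) :
    ContDiffOn ℝ r (fun x => curvForm (t x) (τ x) (a x)) s := by
  have h : ∀ k, ContDiffOn ℝ r (fun x => ∑ i, t x i • a x k i) s := fun k =>
    ContDiffOn.sum fun i _ => (ht i).smul (ha k i)
  simp only [curvForm]
  exact ((ContDiffOn.sum fun i _ => ((hτ 0 i).smul (ha 1 i)).sub ((hτ 1 i).smul (ha 0 i))).sub
    (ContDiffOn.sum fun i _ => (ht i).smul (((ha 0 i).mul (ha 1 i)).sub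
      ((ha 1 i).mul (ha 0 i))))).add (((h 0).mul (h 1)).sub ((h 1).mul (h 0)))

end Smooth

theorem hasFDerivAt_prodMap_gammaSection (x : (Fin q → ℝ) × (Fin q → Mat n)) :
    HasFDerivAt (Prod.map (id : (Fin q → ℝ) → _) (gammaSection n q))
      ((ContinuousLinearMap.id ℝ (Fin q → ℝ)).prodMap (fderiv ℝ (gammaSection n q) x.2)) x :=
  HasFDerivAt.prodMap x (hasFDerivAt_id x.1)
    ((contDiff_gammaSection.differentiable one_ne_zero) x.2).hasFDerivAt

theorem chernCharacterDescent_apply (p : ℕ) (x : (Fin q → ℝ) × (Fin q → Mat n))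
    (v : Fin (2 * p) → (Fin q → ℝ) × (Fin q → Mat n)) :
    chernCharacterDescent n p q x v = (1 / (p.factorial : ℂ) *
      (-1 / (2 * Real.pi * Complex.I) : ℂ) ^ p) *
      matTrace n (wedgePow (pullback (Prod.map id (gammaSection n q)) (curvature n q) x) p
        (fun i => v (Fin.cast (Nat.mul_comm p 2) i))) := by
  rw [chernCharacterDescent, pullback_apply, chernCharacterForm_apply]
  congr 2
  exact (wedgePow_map (f := curvature n q (Prod.map id (gammaSection n q) x))
    (f' := pullback (Prod.map id (gammaSection n q)) (curvature n q) x) (AlgHom.id ℝ (Mat n)) _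
    (fun _ => rfl) p (fun i => v (Fin.cast (Nat.mul_comm p 2) i))).symm

theorem pullback_gammaSection_curvature_apply (x : (Fin q → ℝ) × (Fin q → Mat n))
    (hx : x.2 ∈ NG n q) (w : Fin 2 → (Fin q → ℝ) × (Fin q → Mat n)) :
    pullback (Prod.map id (gammaSection n q)) (curvature n q) x w =
      curvForm (bary x.1) (fun k => baryLin q (w k).1)
        (fun k i => Ring.inverse (gammaSection n q x.2 i) *
          fderiv ℝ (gammaSection n q) x.2 (w k).2 i) := by
  rw [pullback_apply, (hasFDerivAt_prodMap_gammaSection x).fderiv,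
    curvature_apply n q (Prod.map id (gammaSection n q) x) (isUnit_gammaSection hx)]
  rfl

theorem contDiffOn_chernCharacterDescent (p : ℕ) {r : WithTop ℕ∞} :
    ContDiffOn ℝ r (chernCharacterDescent n p q) (simplex q ×ˢ NG n q) := by
  intro x hx
  refine contDiffWithinAt_alt fun v => ?_
  revert x
  change ContDiffOn ℝ r _ _
  simp only [chernCharacterDescent_apply]
  refine contDiffOn_const.mul ((matTrace n).contDiff.comp_contDiffOn
    (contDiffOn_wedgePow_apply (fun w => ?_) p _))
  refine ContDiffOn.congr ?_ fun x hx => pullback_gammaSection_curvature_apply x hx.2 w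
  refine contDiffOn_curvForm (fun i => ?_) (fun k i => contDiffOn_const) (fun k i => ?_)
  · exact ((contDiff_pi.1 contDiff_bary i).comp contDiff_fst).contDiffOn
  · refine ContDiffOn.mul (fun x hx => ?_) ?_
    · refine ContDiffAt.contDiffWithinAt (ContDiffAt.comp (g := Ring.inverse) x
        (contDiffAt_inverse_of_isUnit (isUnit_gammaSection hx.2 i))
        ((contDiff_pi.1 contDiff_gammaSection i).comp contDiff_snd).contDiffAt)
    · have h : ContDiff ℝ r (fun h => fderiv ℝ (gammaSection n q) h (w k).2) :=
        (contDiff_gammaSection.fderiv_right le_rfl).clm_apply contDiff_const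
      exact ((contDiff_pi.1 h i).comp contDiff_snd).contDiffOn

theorem isChernCharacterSimplicialForm_chernCharacterDescent (n p : ℕ) :
    IsChernCharacterSimplicialForm n p (chernCharacterDescent n p) :=
  ⟨⟨fun _ => contDiffOn_chernCharacterDescent p, fun _ i x hx =>
    pullback_face_chernCharacterDescent p i x hx.2⟩, fun _ x hx =>
    pullback_gammaMap_chernCharacterDescent p x hx.2⟩

/-- Near a point of `N G` one has `γ ∘ σ = id`, hence `Φ = σ^* γ^* Φ = σ^* ch_p(Ω)`. -/
theorem IsChernCharacterSimplicialForm.eq_chernCharacterDescent {p : ℕ}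
    {Φ : ∀ q, DForm ((Fin q → ℝ) × (Fin q → Mat n)) ℂ (2 * p)}
    (hΦ : IsChernCharacterSimplicialForm n p Φ) {x : (Fin q → ℝ) × (Fin q → Mat n)}
    (hx : x ∈ simplex q ×ˢ NG n q) : Φ q x = chernCharacterDescent n p q x := by
  have h1 := pullback_congr (Prod.map id (gammaSection n q)) (x := x)
    (hΦ.2 q (Prod.map id (gammaSection n q) x) ⟨hx.1, isUnit_gammaSection hx.2⟩)
  have h2 : DifferentiableAt ℝ (Prod.map (id : (Fin q → ℝ) → _) (gammaMap n q))
      (Prod.map id (gammaSection n q) x) :=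
    DifferentiableAt.prodMap _ differentiableAt_id
      (differentiableAt_gammaMap (isUnit_gammaSection hx.2))
  have h3 : Prod.map (id : (Fin q → ℝ) → _) (gammaMap n q) ∘ Prod.map id (gammaSection n q)
      =ᶠ[nhds x] id :=
    Filter.eventually_of_mem ((isOpen_NG.preimage continuous_snd).mem_nhds hx.2)
      fun y hy => Prod.ext rfl (gammaMap_gammaSection hy)
  rw [pullback_pullback _ h2 (hasFDerivAt_prodMap_gammaSection x).differentiableAt,
    pullback_eq_of_eventuallyEq _ h3, pullback_id] at h1
  exact h1

end

section

/-! ### The component on `N G (1)` -/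

/-- This is the Beta integral `B(m + 1, m + 1)`. -/
theorem integral_mul_one_sub_pow (m : ℕ) :
    ∫ x in (0 : ℝ)..1, (x * (1 - x)) ^ m =
      (m.factorial : ℝ) * m.factorial / (2 * m + 1).factorial := by
  have h := Complex.Gamma_mul_Gamma_eq_betaIntegral (s := (m : ℂ) + 1) (t := (m : ℂ) + 1)
    (by simp; positivity) (by simp; positivity)
  have h1 : ((m : ℂ) + 1) + (m + 1) = ((2 * m + 1 : ℕ) : ℂ) + 1 := by push_cast; ring
  have h2 : Complex.betaIntegral ((m : ℂ) + 1) ((m : ℂ) + 1) =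
      ((∫ x in (0 : ℝ)..1, (x * (1 - x)) ^ m : ℝ) : ℂ) := by
    rw [Complex.betaIntegral, ← intervalIntegral.integral_ofReal]
    congr 1
    funext x
    simp [mul_pow]
  rw [h1, h2, Complex.Gamma_nat_eq_factorial, Complex.Gamma_nat_eq_factorial] at h
  have h3 : (m.factorial : ℝ) * m.factorial =
      (2 * m + 1).factorial * ∫ x in (0 : ℝ)..1, (x * (1 - x)) ^ m := by exact_mod_cast h
  rw [h3, mul_div_cancel_left₀]
  positivity

theorem simplex_one : simplex 1 = MeasurableEquiv.funUnique (Fin 1) ℝ ⁻¹' Set.Icc 0 1 := by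
  ext t
  simp [simplex]

theorem measurableSet_simplex_one : MeasurableSet (simplex 1) := by
  rw [simplex_one]
  exact (MeasurableEquiv.measurable _) measurableSet_Icc

theorem integral_simplex_one (m : ℕ) :
    ∫ t in simplex 1, (t 0 * (1 - t 0)) ^ m =
      (m.factorial : ℝ) * m.factorial / (2 * m + 1).factorial := by
  rw [← integral_mul_one_sub_pow, intervalIntegral.integral_of_le zero_le_one,
    ← MeasureTheory.integral_Icc_eq_integral_Ioc, simplex_one]
  exact (MeasureTheory.volume_preserving_funUnique (Fin 1) ℝ).setIntegral_preimage_emb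
    (MeasurableEquiv.measurableEmbedding _) (fun x : ℝ => (x * (1 - x)) ^ m) (Set.Icc 0 1)

variable {n : ℕ}

theorem fderiv_gammaSection_one (h w : Fin 1 → Mat n) :
    fderiv ℝ (gammaSection n 1) h w = ![w 0, 0] := by
  let D : (Fin 1 → Mat n) →L[ℝ] (Fin 2 → Mat n) :=
    ContinuousLinearMap.pi ![ContinuousLinearMap.proj 0, 0]
  have hD : HasFDerivAt (gammaSection n 1) D h := by
    have e : gammaSection n 1 = fun h => ![0, 1] + D h := by
      funext h i
      fin_cases i <;> simp [gammaSection, D]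
    rw [e]
    exact D.hasFDerivAt.const_add _
  rw [hD.fderiv]
  funext i
  fin_cases i <;> simp [D]

/-- For `q = 1` the last entry of the section is the constant `1`, so its Maurer–Cartan value
vanishes. The commutator then has coefficient `t₀² - t₀ = -t₀ (1 - t₀)`. -/
theorem curvForm_two {A : Type*} [Ring A] [Algebra ℝ A] (t : Fin 2 → ℝ) (τ : Fin 2 → Fin 2 → ℝ)
    (a : Fin 2 → Fin 2 → A) (h : ∀ k, a k 1 = 0) :
    curvForm t τ a = τ 0 0 • a 1 0 - τ 1 0 • a 0 0 -
      (t 0 * (1 - t 0)) • (a 0 0 * a 1 0 - a 1 0 * a 0 0) := by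
  simp only [curvForm, Fin.sum_univ_two, h, mul_zero, smul_zero, sub_zero, add_zero,
    smul_mul_smul_comm]
  module

/-- Since `t₀ = 1 - t₁`, the negated curvature has exactly the shape `δ ∧ ω + s ω ∧ ω` required by
`wedgePow_cons_apply`, with `δ = dt₁` and `s = t₁ (1 - t₁)`. -/
theorem neg_pullback_curvature_one_apply (t : Fin 1 → ℝ) {h : Fin 1 → Mat n} (hh : h ∈ NG n 1)
    (u : Fin 2 → (Fin 1 → ℝ) × (Fin 1 → Mat n)) :
    ((-1 : ℂ) • pullback (Prod.map id (gammaSection n 1)) (curvature n 1) (t, h)) u =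
      (u 0).1 0 • (Ring.inverse (h 0) * (u 1).2 0) - (u 1).1 0 • (Ring.inverse (h 0) * (u 0).2 0) +
        (t 0 * (1 - t 0)) • (Ring.inverse (h 0) * (u 0).2 0 * (Ring.inverse (h 0) * (u 1).2 0) -
          Ring.inverse (h 0) * (u 1).2 0 * (Ring.inverse (h 0) * (u 0).2 0)) := by
  have h0 : gammaSection n 1 h 0 = h 0 := by simp [gammaSection]
  have e0 : baryLin 1 (u 0).1 0 = -(u 0).1 0 := by simp [baryLin_apply]
  have e1 : baryLin 1 (u 1).1 0 = -(u 1).1 0 := by simp [baryLin_apply]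
  have e2 : bary t 0 = 1 - t 0 := by simp [bary]
  rw [ContinuousAlternatingMap.smul_apply, pullback_gammaSection_curvature_apply (t, h) hh,
    curvForm_two _ _ _ (by simp [fderiv_gammaSection_one])]
  simp only [fderiv_gammaSection_one, Matrix.cons_val_zero, h0, e0, e1, e2, neg_one_smul]
  module

theorem trMaurerCartanPow_apply (m : ℕ) (h : Fin 1 → Mat n) (w : Fin m → Fin 1 → Mat n) :
    trMaurerCartanPow n m h w = matTrace n
      (castDeg (Nat.mul_one m) (wedgePow (maurerCartan n (h 0)) m) (fun i => w i 0)) := by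
  rw [trMaurerCartanPow, pullback_apply, (hasFDerivAt_apply 0 h).fderiv]
  rfl

/-- The contraction of the simplicial Chern character form with `∂/∂t₁`. -/
theorem chernCharacterDescent_one_cons (m l : ℕ) (hl : l = 2 * m + 1) (hk : 2 * (m + 1) = 1 + l)
    (t : Fin 1 → ℝ) {h : Fin 1 → Mat n} (hh : h ∈ NG n 1) (w : Fin l → Fin 1 → Mat n) :
    castDeg hk (chernCharacterDescent n (m + 1) 1 (t, h))
        (Fin.append (fun i : Fin 1 => ((Pi.single i 1 : Fin 1 → ℝ), (0 : Fin 1 → Mat n)))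
          (fun i => ((0 : Fin 1 → ℝ), w i))) =
      (((t 0 * (1 - t 0)) ^ m : ℝ) : ℂ) * ((1 / ((m + 1).factorial : ℂ) *
        (1 / (2 * Real.pi * Complex.I) : ℂ) ^ (m + 1) * (m + 1)) * trMaurerCartanPow n l h w) := by
  -- Keeping `l` a variable up to here lets the degree also be spelled `2 * (m + 1) - 1`, as in the
  -- final statement.
  subst hl
  set K := pullback (Prod.map id (gammaSection n 1)) (curvature n 1) (t, h) with hK
  let ω' : Alt ((Fin 1 → ℝ) × (Fin 1 → Mat n)) (Mat n) 1 :=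
    (maurerCartan n (h 0)).compContinuousLinearMap
      ((ContinuousLinearMap.proj (R := ℝ) (φ := fun _ : Fin 1 => Mat n) 0).comp
        (ContinuousLinearMap.snd ℝ (Fin 1 → ℝ) (Fin 1 → Mat n)))
  have hω' : ∀ v, ω' v = Ring.inverse (h 0) * (v 0).2 0 := fun v => rfl
  have key := wedgePow_cons_apply ((-1 : ℂ) • K) ω' (fun v => v.1 0) (t 0 * (1 - t 0))
    (fun u => by rw [hK, neg_pullback_curvature_one_apply t hh]; rfl) m
    ((Pi.single 0 1 : Fin 1 → ℝ), (0 : Fin 1 → Mat n)) (fun i => ((0 : Fin 1 → ℝ), w i))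
    (by simp) (by simp [hω']) (by simp) (by omega) (by omega)
  rw [castDeg_apply, castDeg_apply, wedgePow_smul, ContinuousAlternatingMap.smul_apply] at key
  have hω'' : wedgePow ω' (2 * m + 1) (fun i => ((0 : Fin 1 → ℝ), w (Fin.cast (by omega) i))) =
      wedgePow (maurerCartan n (h 0)) (2 * m + 1) (fun i => w (Fin.cast (by omega) i) 0) :=
    wedgePow_map (f := maurerCartan n (h 0)) (f' := ω') (AlgHom.id ℝ (Mat n))
    (fun v => v.2 0) (fun _ => rfl) (2 * m + 1)
    (fun i => ((0 : Fin 1 → ℝ), w (Fin.cast (by omega) i)))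
  rw [castDeg_apply, chernCharacterDescent_apply, trMaurerCartanPow_apply, castDeg_apply]
  have hv : (fun i : Fin ((m + 1) * 2) => Fin.append
      (fun i : Fin 1 => ((Pi.single i 1 : Fin 1 → ℝ), (0 : Fin 1 → Mat n)))
      (fun i => ((0 : Fin 1 → ℝ), w i)) (Fin.cast hk (Fin.cast (Nat.mul_comm (m + 1) 2) i))) =
      fun i => (Fin.cons ((Pi.single 0 1 : Fin 1 → ℝ), (0 : Fin 1 → Mat n))
        (fun i => ((0 : Fin 1 → ℝ), w i)) : Fin (2 * m + 1 + 1) → _)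
        (Fin.cast (by omega) i) := by
    rw [Fin.append_left_eq_cons]
    rfl
  rw [hv]
  -- The power formula concerns `-Ω`. Multiplying it by the self-inverse sign `(-1)^(m+1)` isolates
  -- the trace of the power of `Ω`, and the same sign returns from `(-1 / 2πi)^(m+1)`.
  have hsq : ((-1 : ℂ) ^ (m + 1)) * (-1) ^ (m + 1) = 1 := by
    rw [← mul_pow]; norm_num
  have hs : ∀ (c : ℂ) (a : Mat n), matTrace n (c • a) = c * matTrace n a := fun c a =>
    Matrix.trace_smul (R := ℂ) c a
  have key2 := congrArg (fun a => (-1 : ℂ) ^ (m + 1) * matTrace n a) key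
  simp only [hs, map_smul] at key2
  rw [← mul_assoc, hsq, one_mul] at key2
  rw [key2, hω'']
  have hc : (-1 / (2 * Real.pi * Complex.I) : ℂ) ^ (m + 1) =
      (1 / (2 * Real.pi * Complex.I) : ℂ) ^ (m + 1) * (-1) ^ (m + 1) := by
    rw [← mul_pow]; congr 1; ring
  rw [hc, Complex.real_smul]
  push_cast
  linear_combination (1 / ((m + 1).factorial : ℂ) * (1 / (2 * Real.pi * Complex.I) : ℂ) ^ (m + 1) *
    ((m + 1) * (t 0 * (1 - t 0)) ^ m) * matTrace n (wedgePow (maurerCartan n (h 0)) (2 * m + 1)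
      (fun i => w (Fin.cast (by omega) i) 0))) * hsq

theorem fiberIntegral_one_chernCharacterDescent (m l : ℕ) (hl : l = 2 * m + 1)
    (hk : 2 * (m + 1) = 1 + l) {Φ : DForm ((Fin 1 → ℝ) × (Fin 1 → Mat n)) ℂ (2 * (m + 1))}
    {h : Fin 1 → Mat n} (hh : h ∈ NG n 1)
    (hΦ : ∀ t ∈ simplex 1, Φ (t, h) = chernCharacterDescent n (m + 1) 1 (t, h)) :
    fiberIntegral 1 l (2 * (m + 1)) hk Φ h =
      ((1 / ((m + 1).factorial : ℂ)) * (1 / (2 * Real.pi * Complex.I)) ^ (m + 1) *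
        (1 / (l.choose m : ℂ))) • trMaurerCartanPow n l h := by
  have h1 : fiberIntegral 1 l (2 * (m + 1)) hk Φ h =
      ∫ t in simplex 1, ((t 0 * (1 - t 0)) ^ m : ℝ) • ((1 / ((m + 1).factorial : ℂ) *
        (1 / (2 * Real.pi * Complex.I) : ℂ) ^ (m + 1) * (m + 1)) • trMaurerCartanPow n l h) := by
    refine MeasureTheory.setIntegral_congr_fun measurableSet_simplex_one fun t ht => ?_
    ext w
    have h2 := chernCharacterDescent_one_cons m l hl hk t hh w
    rw [← hΦ t ht] at h2
    rw [ContinuousAlternatingMap.smul_apply, ContinuousAlternatingMap.smul_apply,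
      Complex.real_smul, smul_eq_mul, ← h2]
    rfl
  rw [h1, integral_smul_const, integral_simplex_one, ← Complex.coe_smul, smul_smul]
  congr 1
  subst hl
  -- The constant is `(m + 1) (m!)² / (2m + 1)! = m! (m + 1)! / (2m + 1)!`, the inverse of the
  -- binomial coefficient.
  rw [Nat.cast_choose ℂ (by omega : m ≤ 2 * m + 1), show 2 * m + 1 - m = m + 1 by omega]
  have h3 : ((m + 1).factorial : ℂ) = (m + 1) * m.factorial := by
    rw [Nat.factorial_succ]; push_cast; ring
  have h4 : (m.factorial : ℂ) ≠ 0 := by exact_mod_cast m.factorial_ne_zero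
  have h5 : ((2 * m + 1).factorial : ℂ) ≠ 0 := by exact_mod_cast (2 * m + 1).factorial_ne_zero
  have h6 : (m + 1 : ℂ) ≠ 0 := by exact_mod_cast m.succ_ne_zero
  rw [h3]
  push_cast
  field_simp

end

end SimplicialDeRham

end

theorem mainTheorem4 (n p : ℕ) (hp : 1 ≤ p) :
    (∃ Φ : ∀ q, SimplicialDeRham.DForm ((Fin q → ℝ) × (Fin q → SimplicialDeRham.Mat n)) ℂ (2 * p),
      SimplicialDeRham.IsChernCharacterSimplicialForm n p Φ) ∧
    ∀ Φ : ∀ q, SimplicialDeRham.DForm ((Fin q → ℝ) × (Fin q → SimplicialDeRham.Mat n)) ℂ (2 * p),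
      SimplicialDeRham.IsChernCharacterSimplicialForm n p Φ →
      ∀ h ∈ SimplicialDeRham.NG n 1,
        SimplicialDeRham.fiberIntegral 1 (2 * p - 1) (2 * p) (by omega) (Φ 1) h =
          ((1 / (p.factorial : ℂ)) * (1 / (2 * Real.pi * Complex.I)) ^ p *
              (1 / ((2 * p - 1).choose (p - 1) : ℂ))) •
            SimplicialDeRham.trMaurerCartanPow n (2 * p - 1) h := by
  refine ⟨⟨_, SimplicialDeRham.isChernCharacterSimplicialForm_chernCharacterDescent n p⟩,
    fun Φ hΦ h hh => ?_⟩
  obtain ⟨m, rfl⟩ : ∃ m, p = m + 1 := ⟨p - 1, by omega⟩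
  exact SimplicialDeRham.fiberIntegral_one_chernCharacterDescent m (2 * (m + 1) - 1) (by omega) _ hh
    fun t ht => hΦ.eq_chernCharacterDescent ⟨ht, hh⟩
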